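/- Let $K$ be a field and let $K_0(\mathcal V_K)$ be the Grothendieck ring of varieties over $K$: it is generated as an abelian group by the isomorphism classes $[X]$ of varieties over $K$ (separated schemes of finite type), with relations $[X]=[Y]+[X\smallsetminus Y]$ for closed subvarieties $Y\subset X$ and with product $[X]\cdot[Y]=[X\times_K Y]$. Put $\mathbb T=[\mathbb A^1]-1\in K_0(\mathcal V_K)$. Graphs are finite; parallel edges and looping edges are allowed. For a graph $G$ with edge set $E$ let $$\Psi_G(t)=\sum_F\ \prod_{d\in E\smallsetminus F} t_d\ \in K[t_d : d\in E],$$ where $F$ runs over (the edge sets of) the spanning trees of $G$, or, if $G$ is not connected, over the spanning forests of $G$ with the same connected components as $G$. The Grothendieck class of $G$ is $\mathbb U(G)=[\mathbb A^{E}\smallsetminus\{\Psi_G=0\}]\in K_0(\mathcal V_K)$. For an edge $e$, $G\smallsetminus e$ denotes $G$ with $e$ deleted; $e$ is a bridge if its ends are not connected in $G\smallsetminus e$. The $(1,3,1)$-bananification of an edge $e$ with ends $x,y$ replaces $e$ by a string consisting of a single edge from $x$ to a new vertex $p$, three parallel edges from $p$ to a new vertex $q$, and a single edge from $q$ to $y$.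 Let $G$ be a graph and $e$ an edge of $G$. Let $G_0=G$, let $G_1$ be obtained from $G$ by the $(1,3,1)$-bananification of $e$, and, for $n\ge 1$, let $G_{n+1}$ be obtained from $G_n$ by the $(1,3,1)$-bananification of one of the three parallel edges created in the construction of $G_n$ from $G_{n-1}$. Then, with $r=\mathbb T(\mathbb T+1)^2\rho$, the following identities hold in $K_0(\mathcal V_K)[[\rho]]$. If $e$ is a bridge of $G$, then $$\sum_{n\ge 0}\mathbb U(G_n)\,\rho^n=\frac{1-r}{1-(\mathbb T+2)\,r+2r^2}\cdot\mathbb U(G).$$ If $e$ is not a bridge of $G$, then $$\sum_{n\ge 0}\mathbb U(G_n)\,\rho^n=\frac{\mathbb U(G)+\big((\mathbb T-1)\,\mathbb U(G\smallsetminus e)-\mathbb U(G)\big)\,r}{1-(\mathbb T+2)\,r+2r^2}.$$ -/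

import Mathlib

open CategoryTheory AlgebraicGeometry

universe u v

/-! ### Varieties and their Grothendieck ring -/

/-- The property of being a variety over `K`: a separated scheme of finite type over `Spec K`.
(Requiring reducedness in addition would not change the Grothendieck ring, because
the scissor relation identifies the class of a scheme with the class of its reduction.) -/
def isVariety (K : Type u) [Field K] : ObjectProperty (Over (Spec (CommRingCat.of K))) :=
  fun X => IsSeparated X.hom ∧ LocallyOfFiniteType X.hom ∧ QuasiCompact X.hom

/-- Varieties over `K` are stable under products over `K` and contain the point `Spec K`. -/
instance isVariety_isMonoidal (K : Type u) [Field K] : (isVariety K).IsMonoidal where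
  prop_unit := by
    refine ⟨?_, ?_, ?_⟩ <;> dsimp <;> infer_instance
  prop_tensor X Y hX hY := by
    obtain ⟨_, _, _⟩ := hX
    obtain ⟨_, _, _⟩ := hY
    refine ⟨?_, ?_, ?_⟩ <;> dsimp <;> infer_instance

/-- The category of varieties over `K`, with `K`-morphisms. Its monoidal structure is the
product of varieties over `K`. -/
abbrev Variety (K : Type u) [Field K] := (isVariety K).FullSubcategory

/-- The scissor relations `[X] - [Z] - [U]`, for `Z` a closed subvariety of `X` and `U` its open
complement, in the ring of formal integral combinations of isomorphism classes of varieties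
(in which the product of two classes is the class of the product over `K`). -/
def scissorRelations (K : Type u) [Field K] :
    Set (MonoidAlgebra ℤ (Skeleton (Variety K))) :=
  {a | ∃ (X Z U : Variety K) (i : Z ⟶ X) (j : U ⟶ X),
    IsClosedImmersion i.hom.left ∧ IsOpenImmersion j.hom.left ∧
    Set.range j.hom.left = (Set.range i.hom.left)ᶜ ∧
    a = MonoidAlgebra.of ℤ _ (toSkeleton X) - MonoidAlgebra.of ℤ _ (toSkeleton Z)
      - MonoidAlgebra.of ℤ _ (toSkeleton U)}

/-- The Grothendieck ring `K₀(Var_K)`: the free abelian group on isomorphism classes of varieties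
modulo the scissor relations, with `[X] * [Y] = [X × Y]`. -/
abbrev GrothendieckRing (K : Type u) [Field K] :=
  MonoidAlgebra ℤ (Skeleton (Variety K)) ⧸ Ideal.span (scissorRelations K)

noncomputable section

/-- The class `[X]` of a variety in the Grothendieck ring. -/
def varietyClass {K : Type u} [Field K] (X : Variety K) : GrothendieckRing K :=
  Ideal.Quotient.mk _ (MonoidAlgebra.of ℤ _ (toSkeleton X))

/-- The structure morphism of the affine space `Spec K[t_i : i ∈ σ]`. -/
abbrev affineSpaceHom (K : Type u) [Field K] (σ : Type u) :
    Spec (CommRingCat.of (MvPolynomial σ K)) ⟶ Spec (CommRingCat.of K) :=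
  Spec.map (CommRingCat.ofHom MvPolynomial.C)

instance affineSpaceHom_locallyOfFiniteType (K : Type u) [Field K] (σ : Type u) [Finite σ] :
    LocallyOfFiniteType (affineSpaceHom K σ) := by
  rw [HasRingHomProperty.Spec_iff (P := @LocallyOfFiniteType)]
  exact RingHom.finiteType_algebraMap (A := K) (B := MvPolynomial σ K) |>.2 inferInstance

/-- The affine space `Spec K[t_i : i ∈ σ]`. -/
def affineSpace (K : Type u) [Field K] (σ : Type u) [Finite σ] : Variety K where
  obj := Over.mk (affineSpaceHom K σ)
  property :=
    ⟨inferInstanceAs (IsSeparated (affineSpaceHom K σ)),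
      inferInstanceAs (LocallyOfFiniteType (affineSpaceHom K σ)),
      inferInstanceAs (QuasiCompact (affineSpaceHom K σ))⟩

/-- The open subset `f ≠ 0` of the affine space `Spec K[t_i : i ∈ σ]`. -/
def nonvanishingLocus (K : Type u) [Field K] {σ : Type u} (f : MvPolynomial σ K) :
    (Spec (CommRingCat.of (MvPolynomial σ K))).Opens :=
  PrimeSpectrum.basicOpen f

/-- The complement of the hypersurface `f = 0` in the affine space `Spec K[t_i : i ∈ σ]`,
as an open subscheme. -/
def hypersurfaceComplement (K : Type u) [Field K] {σ : Type u} [Finite σ]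
    (f : MvPolynomial σ K) : Variety K where
  obj := Over.mk ((nonvanishingLocus K f).ι ≫ affineSpaceHom K σ)
  property := by
    refine ⟨?_, ?_, ?_⟩ <;> dsimp only [Over.mk_hom] <;> infer_instance

/-- The Lefschetz motive `𝕃 = [𝔸¹]`. -/
def lefschetzClass (K : Type u) [Field K] : GrothendieckRing K :=
  varietyClass (affineSpace K PUnit)

/-- The class `𝕋 = 𝕃 - 1` of the one-dimensional torus. -/
def torusClass (K : Type u) [Field K] : GrothendieckRing K :=
  lefschetzClass K - 1

end

/-! ### Graphs, spanning forests and the Kirchhoff--Symanzik polynomial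

Graphs are multigraphs; parallel edges and looping edges are allowed. -/

open scoped Graph

/-- Two vertices are joined by a path of `G` all of whose edges belong to `F`. -/
def Graph.ConnectedIn {α : Type v} {β : Type u} (G : Graph α β) (F : Set β) (x y : α) : Prop :=
  Relation.ReflTransGen (fun a b => ∃ d ∈ F, G.IsLink d a b) x y

/-- `e` is a bridge of `G`: it is an edge, and its ends are not connected in `G ∖ e`. -/
def Graph.IsBridge {α : Type v} {β : Type u} (G : Graph α β) (e : β) : Prop :=
  ∃ x y, G.IsLink e x y ∧ ¬ G.ConnectedIn (E(G) \ {e}) x y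

/-- `F` is the edge set of a spanning forest of `G`, that is, of a subgraph with the same vertices
and the same connected components as `G` and without cycles. If `G` is connected,
these are the spanning trees of `G`. -/
def Graph.IsSpanningForest {α : Type v} {β : Type u} (G : Graph α β) (F : Set β) : Prop :=
  F ⊆ E(G) ∧
  (∀ x y, G.ConnectedIn E(G) x y → G.ConnectedIn F x y) ∧
  ∀ d ∈ F, ∀ x y, G.IsLink d x y → ¬ G.ConnectedIn (F \ {d}) x y

noncomputable section

open scoped Classical in
/-- The Kirchhoff--Symanzik polynomial `Ψ_G = ∑_F ∏_{d ∉ F} t_d` of a finite graph, with one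
variable for every edge; the sum is over the spanning forests (spanning trees if `G` is
connected). -/
def Graph.symanzikPolynomial (K : Type u) [Field K] {α : Type v} {β : Type u} (G : Graph α β)
    [Finite E(G)] : MvPolynomial E(G) K :=
  letI : Fintype E(G) := Fintype.ofFinite E(G)
  ∑ F ∈ Finset.univ.filter
      (fun F : Finset E(G) => G.IsSpanningForest (Subtype.val '' (F : Set E(G)))),
    ∏ d ∈ Fᶜ, MvPolynomial.X d

/-- The Grothendieck class `𝕌(G)` of the complement, in the affine space whose coordinates are
the edges of `G`, of the affine graph hypersurface `Ψ_G = 0`. -/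
def Graph.grothendieckClass (K : Type u) [Field K] {α : Type v} {β : Type u} (G : Graph α β)
    [Finite E(G)] : GrothendieckRing K :=
  varietyClass (hypersurfaceComplement K (G.symanzikPolynomial K))

end

/-- The deletion of edges from a finite graph is a finite graph. -/
instance Graph.finite_edgeSet_deleteEdges {α : Type v} {β : Type u} (G : Graph α β)
    [Finite E(G)] (F : Set β) : Finite E(G.deleteEdges F) :=
  Set.Finite.subset (Set.toFinite E(G)) (by simp)

/-! ### Bananification -/

/-- `H` is obtained from `G` by the `(1,3,1)`-bananification of the edge `e`: the edge `e`, with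
ends `x` and `y`, is replaced by a string of a `1`-banana, a `3`-banana and a `1`-banana.
That is, there are two new vertices `p` and `q`, a new edge `a` joining `x` and `p`, three new
parallel edges `b 0`, `b 1`, `b 2` joining `p` and `q`, and a new edge `c` joining `q` and `y`.
Moreover `f` is one of the three parallel edges. -/
def Graph.IsBananification {α : Type v} {β : Type u} (G : Graph α β) (e : β)
    (H : Graph α β) (f : β) : Prop :=
  ∃ (x y p q : α) (a c : β) (b : Fin 3 → β),
    G.IsLink e x y ∧
    (p ∉ V(G) ∧ q ∉ V(G) ∧ p ≠ q) ∧
    (a ∉ E(G) ∧ c ∉ E(G) ∧ (∀ i, b i ∉ E(G)) ∧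
      a ≠ c ∧ (∀ i, b i ≠ a) ∧ (∀ i, b i ≠ c) ∧ Function.Injective b) ∧
    V(H) = V(G) ∪ {p, q} ∧
    (∀ d z w, H.IsLink d z w ↔
      (d ≠ e ∧ G.IsLink d z w) ∨
      (d = a ∧ s(z, w) = s(x, p)) ∨
      ((∃ i, d = b i) ∧ s(z, w) = s(p, q)) ∨
      (d = c ∧ s(z, w) = s(q, y))) ∧
    ∃ i, f = b i

/-- The graphs `Γ 0 = G, Γ 1, Γ 2, …` form a chain of `(1,3,1)`-bananifications starting at the
edge `e`: the first one is performed on `ε 0 = e`, and each of the following ones on one of the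
three parallel edges `ε n` produced by the previous one. -/
structure Graph.IsBananaChain {α : Type v} {β : Type u} (G : Graph α β) (e : β)
    (Γ : ℕ → Graph α β) (ε : ℕ → β) : Prop where
  graph_zero : Γ 0 = G
  edge_zero : ε 0 = e
  step : ∀ n, (Γ n).IsBananification (ε n) (Γ (n + 1)) (ε (n + 1))

/-! Write `Ψ_G = A t_e + B`, where `A` collects the spanning forests that avoid `e` and `B` those
that contain it. Let `U = 𝕌(G)` be the class of `A t_e + B ≠ 0`, and let `V` be the class of `A ≠ 0`
in the affine space of the other edges (`coefficientClass`). If `e` is a bridge, no spanning forest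
avoids it and `V = 0`; otherwise `A = Ψ_{G∖e}` and `V = 𝕌(G∖e)`.

Let `u, v` be the variables of the two outer new edges and `e₂, e₃` the elementary symmetric
polynomials in the three parallel ones. The description of the spanning forests in
`Graph.BananaData.isSpanningForest_iff` shows that the bananified graph has polynomial `A((u + v)e₂
+ e₃) + B e₂`. Deleting a parallel edge gives the same expression with `e₁, e₂` of the two remaining
variables in place of `e₂, e₃`.

Cutting these loci into the strata `A ≠ 0` and `A = 0` and using that both polynomials are linear in
an outer variable (`locusClass_bananaPolynomial`, `locusClass_bananaDeletion`), one finds, with `R =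
𝕋(𝕋 + 1)²`, that `U' = R((𝕋 + 1)U + (𝕋 - 1)V)` and `V' = R(U + V)`. Here `V'` is taken at a new
parallel edge, which is the edge bananified next, so the pair `(U, V)` evolves by a fixed matrix of
trace `R(𝕋 + 2)` and determinant `2R²`. This gives the denominator; solving the linear system for
the series of `U` gives the numerator `U + ((𝕋 - 1)V - U)r`. -/

open CategoryTheory AlgebraicGeometry MonoidalCategory

noncomputable section

/-! ### Classes of affine varieties -/

/-- The affine variety attached to a finitely generated algebra. -/
def affineVariety (K : Type u) [Field K] (R : Type u) [CommRing R] [Algebra K R]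
    [Algebra.FiniteType K R] : Variety K where
  obj := Over.mk (Spec.map (CommRingCat.ofHom (algebraMap K R)))
  property := by
    have : LocallyOfFiniteType (Spec.map (CommRingCat.ofHom (algebraMap K R))) := by
      rw [HasRingHomProperty.Spec_iff (P := @LocallyOfFiniteType)]
      exact RingHom.finiteType_algebraMap.2 inferInstance
    exact ⟨inferInstanceAs (IsSeparated (Spec.map (CommRingCat.ofHom (algebraMap K R)))), this,
      inferInstanceAs (QuasiCompact (Spec.map (CommRingCat.ofHom (algebraMap K R))))⟩

/-- The class of the spectrum of a finitely generated algebra. -/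
def affineClass (K : Type u) [Field K] (R : Type u) [CommRing R] [Algebra K R]
    [Algebra.FiniteType K R] : GrothendieckRing K :=
  varietyClass (affineVariety K R)

section
variable {K : Type u} [Field K]

theorem varietyClass_eq_of_iso {X Y : Variety K} (i : X ≅ Y) : varietyClass X = varietyClass Y := by
  unfold varietyClass
  rw [Quotient.sound (s := isIsomorphicSetoid (Variety K)) ⟨i⟩ |> fun h : toSkeleton X = toSkeleton Y => h]

theorem varietyClass_eq_of_over_iso {X Y : Variety K} (i : X.obj ≅ Y.obj) :
    varietyClass X = varietyClass Y :=
  varietyClass_eq_of_iso ((isVariety K).isoMk i)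

theorem varietyClass_tensor (X Y : Variety K) :
    varietyClass (X ⊗ Y) = varietyClass X * varietyClass Y := by
  unfold varietyClass
  rw [Skeleton.toSkeleton_tensorObj, map_mul, map_mul]

theorem varietyClass_scissor {X Z U : Variety K} (i : Z ⟶ X) (j : U ⟶ X)
    (hi : IsClosedImmersion i.hom.left) (hj : IsOpenImmersion j.hom.left)
    (h : Set.range j.hom.left = (Set.range i.hom.left)ᶜ) :
    varietyClass X = varietyClass Z + varietyClass U := by
  rw [← sub_eq_zero, ← sub_sub]
  unfold varietyClass
  rw [← map_sub, ← map_sub]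
  exact Ideal.Quotient.eq_zero_iff_mem.2 (Ideal.subset_span ⟨X, Z, U, i, j, hi, hj, h, rfl⟩)

variable {R : Type u} [CommRing R] [Algebra K R] [Algebra.FiniteType K R]
  {S : Type u} [CommRing S] [Algebra K S] [Algebra.FiniteType K S]

/-- The morphism of affine varieties attached to a homomorphism of algebras. -/
def affineVarietyMap (f : R →ₐ[K] S) : affineVariety K S ⟶ affineVariety K R :=
  (isVariety K).homMk <| Over.homMk (Spec.map (CommRingCat.ofHom f.toRingHom)) <| by
    dsimp [affineVariety]
    rw [← Spec.map_comp, ← CommRingCat.ofHom_comp]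
    congr 2
    exact f.comp_algebraMap

theorem affineVarietyMap_left (f : R →ₐ[K] S) :
    (affineVarietyMap f).hom.left = Spec.map (CommRingCat.ofHom f.toRingHom) := rfl

/-- The isomorphism of affine varieties attached to an isomorphism of algebras. -/
def affineVarietyIso (f : R ≃ₐ[K] S) : affineVariety K R ≅ affineVariety K S where
  hom := affineVarietyMap f.symm.toAlgHom
  inv := affineVarietyMap f.toAlgHom
  hom_inv_id := by
    apply ObjectProperty.hom_ext
    apply Over.OverMorphism.ext
    change Spec.map _ ≫ Spec.map _ = 𝟙 _
    rw [← Spec.map_comp, ← CommRingCat.ofHom_comp, ← Spec.map_id]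
    congr 1
    ext x
    exact f.symm_apply_apply x
  inv_hom_id := by
    apply ObjectProperty.hom_ext
    apply Over.OverMorphism.ext
    change Spec.map _ ≫ Spec.map _ = 𝟙 _
    rw [← Spec.map_comp, ← CommRingCat.ofHom_comp, ← Spec.map_id]
    congr 1
    ext x
    exact f.apply_symm_apply x

theorem affineClass_congr (f : R ≃ₐ[K] S) : affineClass K R = affineClass K S :=
  varietyClass_eq_of_iso (affineVarietyIso f)

theorem affineClass_scissor {Q P : Type u} [CommRing Q] [Algebra K Q] [Algebra.FiniteType K Q]
    [CommRing P] [Algebra K P] [Algebra.FiniteType K P] [Algebra R P] [IsScalarTower K R P]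
    (a : R) [IsLocalization.Away a P] (φ : R →ₐ[K] Q) (hφ : Function.Surjective φ)
    (hker : RingHom.ker φ = Ideal.span {a}) :
    affineClass K R = affineClass K Q + affineClass K P := by
  refine varietyClass_scissor (affineVarietyMap φ) (affineVarietyMap (IsScalarTower.toAlgHom K R P))
    ?_ ?_ ?_
  · exact IsClosedImmersion.spec_of_surjective _ hφ
  · exact IsOpenImmersion.of_isLocalization (S := P) a
  · rw [affineVarietyMap_left, affineVarietyMap_left]
    change Set.range (PrimeSpectrum.comap (algebraMap R P)) = (Set.range (PrimeSpectrum.comap φ.toRingHom))ᶜ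
    rw [PrimeSpectrum.localization_away_comap_range P a, range_comap_of_surjective _ _ hφ]
    change _ = (PrimeSpectrum.zeroLocus (RingHom.ker φ : Set R))ᶜ
    rw [hker, PrimeSpectrum.zeroLocus_span, PrimeSpectrum.basicOpen_eq_zeroLocus_compl]

theorem affineClass_mul [Algebra.FiniteType K (TensorProduct K R S)] :
    affineClass K R * affineClass K S = affineClass K (TensorProduct K R S) := by
  unfold affineClass
  rw [← varietyClass_tensor]
  refine varietyClass_eq_of_over_iso (Over.isoMk ?_ ?_)
  · exact pullbackSpecIso K R S
  · exact pullbackSpecIso_hom_base K R S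

/-- In the empty scheme, the subscheme `0 = 0` and its complement are both everything, so the
scissor relation reads `[∅] = [∅] + [∅]`. -/
theorem affineClass_eq_zero [Subsingleton R] : affineClass K R = 0 := by
  have : IsLocalization.Away (0 : R) R := IsLocalization.away_of_isUnit_of_bijective R
    (isUnit_of_subsingleton _) Function.bijective_id
  have h := affineClass_scissor (K := K) (P := R) (0 : R) (AlgHom.id K R) Function.surjective_id
    (Subsingleton.elim _ _)
  exact left_eq_add.1 h

instance : Algebra.FiniteType K (Polynomial R) :=
  Algebra.FiniteType.trans (S := R) inferInstance inferInstance

instance (f : R) : Algebra.FiniteType K (Localization.Away f) :=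
  Algebra.FiniteType.trans (S := R) inferInstance
    (IsLocalization.finiteType_of_monoid_fg (Submonoid.powers f) _)

theorem affineClass_polynomial :
    affineClass K (Polynomial R) = lefschetzClass K * affineClass K R := by
  have : Algebra.FiniteType K (TensorProduct K R (Polynomial K)) :=
    Algebra.FiniteType.trans (S := R) inferInstance inferInstance
  rw [mul_comm, affineClass_congr (polyEquivTensor K R), ← affineClass_mul]
  congr 1
  exact affineClass_congr (MvPolynomial.uniqueAlgEquiv K PUnit).symm

theorem hypersurfaceComplement_class {σ : Type u} [Finite σ] (f : MvPolynomial σ K) :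
    varietyClass (hypersurfaceComplement K f) = affineClass K (Localization.Away f) := by
  refine varietyClass_eq_of_over_iso (Over.isoMk (basicOpenIsoSpecAway (R := CommRingCat.of _) f) ?_)
  refine Eq.trans ?_ (congrArg (fun φ => φ ≫ affineSpaceHom K σ)
    (basicOpenIsoSpecAway_hom_SpecMap (R := CommRingCat.of (MvPolynomial σ K)) f))
  refine Eq.trans ?_ (Category.assoc _ _ _).symm
  refine congrArg (fun φ => (basicOpenIsoSpecAway (R := CommRingCat.of (MvPolynomial σ K)) f).hom ≫ φ) ?_
  refine Eq.trans ?_ (Spec.map_comp _ _)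
  rw [← CommRingCat.ofHom_comp]
  exact congrArg (fun φ => Spec.map (CommRingCat.ofHom φ))
    (IsScalarTower.algebraMap_eq K (MvPolynomial σ K) (Localization.Away f))

end
end

/-! ### Calculus of the classes of loci `f ≠ 0` in affine schemes. -/

noncomputable section

open Polynomial

/-- A homomorphism exhibits its target as the localization away from `g`. -/
def IsAwayHom {R P : Type*} [CommRing R] [CommRing P] (ι : R →+* P) (g : R) : Prop :=
  @IsLocalization.Away R _ g P _ ι.toAlgebra

theorem isAwayHom_algebraMap {R : Type*} [CommRing R] (P : Type*) [CommRing P] [Algebra R P] (g : R)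
    [h : IsLocalization.Away g P] : IsAwayHom (algebraMap R P) g := by
  unfold IsAwayHom
  convert h
  ext
  exact (Algebra.smul_def _ _).symm

theorem IsAwayHom.mapRingHom {R P : Type*} [CommRing R] [CommRing P] {ι : R →+* P} {g : R}
    (h : IsAwayHom ι g) : IsAwayHom (Polynomial.mapRingHom ι) (C g) := by
  let _ := ι.toAlgebra
  have : IsLocalization.Away g P := h
  have := Polynomial.isLocalization (Submonoid.powers g) P
  rwa [Submonoid.map_powers] at this

theorem IsAwayHom.isUnit {R P : Type*} [CommRing R] [CommRing P] {ι : R →+* P} {g : R}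
    (h : IsAwayHom ι g) : IsUnit (ι g) := by
  let _ := ι.toAlgebra
  have : IsLocalization.Away g P := h
  exact IsLocalization.Away.algebraMap_isUnit g

section
variable {K R P Q : Type*} [CommRing K] [CommRing R] [Algebra K R] [CommRing P] [Algebra K P]
  [CommRing Q] [Algebra K Q]

theorem isAwayHom_id {u : R} (hu : IsUnit u) : IsAwayHom (AlgHom.id K R : R →+* R) u :=
  IsLocalization.away_of_isUnit_of_bijective R hu Function.bijective_id

theorem isAwayHom_localization (a : R) :
    IsAwayHom (IsScalarTower.toAlgHom K R (Localization.Away a) : R →+* Localization.Away a) a :=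
  isAwayHom_algebraMap (Localization.Away a) a

theorem IsAwayHom.mapAlgHom {ι : R →ₐ[K] P} {g : R} (h : IsAwayHom (ι : R →+* P) g) :
    IsAwayHom (Polynomial.mapAlgHom ι : R[X] →+* P[X]) (C g) :=
  h.mapRingHom

theorem ker_aeval (b : R) : RingHom.ker ((aeval b : R[X] →ₐ[R] R).restrictScalars K) =
    Ideal.span {X - C b} := by
  rw [← Polynomial.ker_evalRingHom]
  rfl

theorem ker_mapAlgHom (a : R) (φ : R →ₐ[K] Q) (hker : RingHom.ker φ = Ideal.span {a}) :
    RingHom.ker (Polynomial.mapAlgHom φ) = Ideal.span {C a} := by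
  have := Polynomial.ker_mapRingHom (φ : R →+* Q)
  rw [show RingHom.ker (φ : R →+* Q) = RingHom.ker φ from rfl, hker, Ideal.map_span,
    Set.image_singleton] at this
  exact this

end

section
variable (K : Type u) [Field K]

/-- The class of the locus `f ≠ 0` in the spectrum of a finitely generated algebra. -/
def locusClass {R : Type u} [CommRing R] [Algebra K R] [Algebra.FiniteType K R] (f : R) :
    GrothendieckRing K :=
  affineClass K (Localization.Away f)

variable {K}
variable {R : Type u} [CommRing R] [Algebra K R] [Algebra.FiniteType K R]
  {S : Type u} [CommRing S] [Algebra K S] [Algebra.FiniteType K S]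
  {Q : Type u} [CommRing Q] [Algebra K Q] [Algebra.FiniteType K Q]
  {P : Type u} [CommRing P] [Algebra K P] [Algebra.FiniteType K P]

theorem affineClass_eq_locusClass [Algebra R P] [IsScalarTower K R P] (f : R)
    [IsLocalization.Away f P] : affineClass K P = locusClass K f :=
  affineClass_congr ((IsLocalization.algEquiv (.powers f) P (Localization.Away f)).restrictScalars K)

theorem locusClass_congr (e : R ≃ₐ[K] S) (f : R) : locusClass K f = locusClass K (e f) :=
  affineClass_congr (IsLocalization.algEquivOfAlgEquiv (M := .powers f) (T := .powers (e f))
    (Localization.Away f) (Localization.Away (e f)) e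
    (by rw [Submonoid.map_powers]))

theorem locusClass_of_isUnit {f : R} (hf : IsUnit f) : locusClass K f = affineClass K R := by
  have : IsLocalization.Away f R :=
    IsLocalization.away_of_isUnit_of_bijective R hf Function.bijective_id
  exact (affineClass_eq_locusClass f).symm

theorem locusClass_zero : locusClass K (0 : R) = 0 := by
  have : Subsingleton (Localization.Away (0 : R)) :=
    IsLocalization.subsingleton (M := .powers (0 : R)) ⟨1, by simp⟩
  exact affineClass_eq_zero

/-- Inside `f ≠ 0`, the open piece `g ≠ 0` is the locus of `f * g`, and the closed piece `g = 0` is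
cut out by the localization of `φ` at `f`, whose kernel is still generated by `g`. -/
theorem locusClass_scissor (f g : R) (φ : R →ₐ[K] Q) (hφ : Function.Surjective φ)
    (hker : RingHom.ker φ = Ideal.span {g}) :
    locusClass K f = locusClass K (f * g) + locusClass K (φ f) := by
  have hT : Submonoid.map (φ : R →+* Q) (.powers f) = .powers (φ f) := by
    rw [Submonoid.map_powers]; rfl
  let ψ : Localization.Away f →ₐ[K] Localization.Away (φ f) :=
    { IsLocalization.map (Localization.Away (φ f)) (φ : R →+* Q)
        (hT.symm ▸ (Submonoid.powers f).le_comap_map) with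
      commutes' := fun r => by
        change IsLocalization.map _ _ _ _ = _
        rw [IsScalarTower.algebraMap_apply K R, IsLocalization.map_eq,
          IsScalarTower.algebraMap_apply K Q (Localization.Away (φ f))]
        congr 1
        exact φ.commutes r }
  have hψ : RingHom.ker ψ = Ideal.span {algebraMap R (Localization.Away f) g} := by
    refine (IsLocalization.ker_map (S := Localization.Away f) (Localization.Away (φ f))
      (φ : R →+* Q) hT).trans ?_
    change Ideal.map _ (RingHom.ker φ) = _
    rw [hker, Ideal.map_span, Set.image_singleton]
  have hψ' : Function.Surjective ψ := by
    have : IsLocalization (Submonoid.map (φ : R →+* Q) (.powers f)) (Localization.Away (φ f)) :=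
      by rw [hT]; infer_instance
    exact IsLocalization.map_surjective_of_surjective _ _ _ hφ
  refine (affineClass_scissor (P := Localization.Away (algebraMap R (Localization.Away f) g))
    _ ψ hψ' hψ).trans ?_
  rw [add_comm]
  congr 1
  exact affineClass_eq_locusClass (f * g)

theorem affineClass_of_isAwayHom {ι : R →ₐ[K] P} {f : R} (h : IsAwayHom (ι : R →+* P) f) :
    affineClass K P = locusClass K f := by
  let _ := ι.toRingHom.toAlgebra
  have : IsScalarTower K R P := .of_algebraMap_eq fun x => (ι.commutes x).symm
  have : IsLocalization.Away f P := h
  exact affineClass_eq_locusClass f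

theorem locusClass_mul {ι : R →ₐ[K] P} {g : R} (h : IsAwayHom (ι : R →+* P) g) (f : R) :
    locusClass K (g * f) = locusClass K (ι f) := by
  let _ := ι.toRingHom.toAlgebra
  have : IsScalarTower K R P := .of_algebraMap_eq fun x => (ι.commutes x).symm
  have : IsLocalization.Away g P := h
  have : IsLocalization.Away (g * f) (Localization.Away (algebraMap R P f)) := inferInstance
  exact (affineClass_eq_locusClass (g * f)).symm

/-- The decomposition of a locus along the subscheme `g = 0`. -/
theorem locusClass_split {ι : R →ₐ[K] P} {g : R} (h : IsAwayHom (ι : R →+* P) g) 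
    (φ : R →ₐ[K] Q) (hφ : Function.Surjective φ) (hker : RingHom.ker φ = Ideal.span {g}) (f : R) :
    locusClass K f = locusClass K (ι f) + locusClass K (φ f) := by
  rw [locusClass_scissor f g φ hφ hker, mul_comm, locusClass_mul h]

theorem locusClass_unit_mul {u : R} (hu : IsUnit u) (f : R) :
    locusClass K (u * f) = locusClass K f :=
  locusClass_mul (isAwayHom_id (K := K) hu) f

theorem locusClass_sq (f : R) : locusClass K (f * f) = locusClass K f := by
  rw [locusClass_mul (isAwayHom_localization (K := K) f)]
  exact locusClass_of_isUnit (IsLocalization.Away.algebraMap_isUnit f)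

theorem locusClass_C_mul (a : R) (f : R[X]) :
    locusClass K (C a * f) = locusClass K (f.map (algebraMap R (Localization.Away a))) :=
  locusClass_mul (isAwayHom_localization (K := K) a).mapAlgHom f

theorem locusClass_C (a : R) : locusClass K (C a) = lefschetzClass K * locusClass K a := by
  rw [← mul_one (C a), locusClass_C_mul, Polynomial.map_one, locusClass_of_isUnit isUnit_one,
    affineClass_polynomial]
  rfl

theorem locusClass_X : locusClass K (X : R[X]) = torusClass K * affineClass K R := by
  have h := locusClass_scissor (K := K) (1 : R[X]) X ((aeval (0 : R)).restrictScalars K)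
    (fun r => ⟨C r, by simp⟩) (by rw [ker_aeval]; simp)
  rw [one_mul, map_one, locusClass_of_isUnit isUnit_one, locusClass_of_isUnit isUnit_one,
    affineClass_polynomial] at h
  rw [torusClass, sub_mul, h, one_mul, add_sub_cancel_right]

theorem locusClass_unit_linear {u : R} (hu : IsUnit u) (b : R) :
    locusClass K (C u * X + C b) = torusClass K * affineClass K R := by
  let _ := hu.invertible
  rw [← locusClass_X, locusClass_congr ((algEquivCMulXAddC u b).restrictScalars K) X]
  simp

/-- The locus where a polynomial of degree at most one in one variable does not vanish. -/
theorem locusClass_polynomial_linear (a b : R) (φ : R →ₐ[K] Q) (hφ : Function.Surjective φ)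
    (hker : RingHom.ker φ = Ideal.span {a}) :
    locusClass K (C a * X + C b) =
      torusClass K * locusClass K a + lefschetzClass K * locusClass K (φ b) := by
  -- Cut along `a = 0`. Where `a` is invertible, `a X + b` is itself a coordinate on the line; where
  -- `a = 0`, the variable is free and the condition is `b ≠ 0`.
  rw [locusClass_scissor _ (C a) (Polynomial.mapAlgHom φ) (Polynomial.map_surjective _ hφ)
    (ker_mapAlgHom a φ hker), mul_comm _ (C a), locusClass_C_mul]
  congr 1
  · simp only [Polynomial.map_add, Polynomial.map_mul, map_C, map_X]
    exact locusClass_unit_linear (IsLocalization.Away.algebraMap_isUnit a) _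
  · have : φ a = 0 := by
      rw [← RingHom.mem_ker, hker]; exact Ideal.mem_span_singleton_self a
    simp [this, locusClass_C]

end
end

/-! ### Iterated polynomial rings. -/

noncomputable section
open Polynomial

/-- The polynomial ring in one variable. This is a synonym of `Polynomial R`, which keeps
instance problems small in iterated polynomial rings. -/
def PolyRing (R : Type u) [CommRing R] : Type u := R[X]

namespace PolyRing
variable {K R S P Q : Type*} [CommRing K] [CommRing R] [Algebra K R] [CommRing S] [Algebra K S]
  [CommRing P] [Algebra K P] [CommRing Q] [Algebra K Q]

instance : CommRing (PolyRing R) := inferInstanceAs (CommRing R[X])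

instance : Algebra K (PolyRing R) := inferInstanceAs (Algebra K R[X])

/-- The constant polynomials. -/
def c : R →+* PolyRing R := C

/-- The variable. -/
def x : PolyRing R := X

/-- The homomorphism of polynomial rings induced by a homomorphism of the coefficients. -/
def map (φ : R →ₐ[K] S) : PolyRing R →ₐ[K] PolyRing S := mapAlgHom φ

@[simp] theorem map_c (φ : R →ₐ[K] S) (r : R) : map φ (c r) = c (φ r) := Polynomial.map_C _

@[simp] theorem map_x (φ : R →ₐ[K] S) : map φ x = x := Polynomial.map_X _

theorem map_surjective {φ : R →ₐ[K] S} (h : Function.Surjective φ) :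
    Function.Surjective (map φ) :=
  Polynomial.map_surjective _ h

theorem ker_map {a : R} {φ : R →ₐ[K] Q} (h : RingHom.ker φ = Ideal.span {a}) :
    RingHom.ker (map φ) = Ideal.span {c a} :=
  ker_mapAlgHom a φ h

theorem isAwayHom_map {ι : R →ₐ[K] P} {g : R} (h : IsAwayHom (ι : R →+* P) g) :
    IsAwayHom (map ι : PolyRing R →+* PolyRing P) (c g) :=
  h.mapAlgHom

theorem algHom_ext {f g : PolyRing R →ₐ[K] S} (h : ∀ r, f (c r) = g (c r)) (hx : f x = g x) :
    f = g :=
  Polynomial.algHom_ext' (AlgHom.ext h) hx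

/-- The exchange of the variables of a polynomial ring in two variables. -/
def swap (K R : Type*) [CommRing K] [CommRing R] [Algebra K R] :
    PolyRing (PolyRing R) ≃ₐ[K] PolyRing (PolyRing R) :=
  AlgEquiv.ofRingEquiv (f := (Bivariate.swap (R := R)).toRingEquiv)
    fun r => Bivariate.swap_C_C (algebraMap K R r)

@[simp] theorem swap_c_c (r : R) : swap K R (c (c r)) = c (c r) := Bivariate.swap_C_C r

@[simp] theorem swap_c_x : swap K R (c x) = x := Bivariate.swap_X

@[simp] theorem swap_x : swap K R x = c x := Bivariate.swap_Y

instance {K R : Type u} [Field K] [CommRing R] [Algebra K R] [Algebra.FiniteType K R] :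
    Algebra.FiniteType K (PolyRing R) :=
  inferInstanceAs (Algebra.FiniteType K R[X])

variable {K : Type u} [Field K] {R : Type u} [CommRing R] [Algebra K R] [Algebra.FiniteType K R]

theorem affineClass_polyRing : affineClass K (PolyRing R) = lefschetzClass K * affineClass K R :=
  affineClass_polynomial

theorem locusClass_c (a : R) : locusClass K (c a) = lefschetzClass K * locusClass K a :=
  locusClass_C a

theorem locusClass_x : locusClass K (x : PolyRing R) = torusClass K * affineClass K R :=
  locusClass_X

/-- The locus where a polynomial of degree at most one in one variable does not vanish. -/
theorem locusClass_linear {Q : Type u} [CommRing Q] [Algebra K Q] [Algebra.FiniteType K Q]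
    (a b : R) (φ : R →ₐ[K] Q) (hφ : Function.Surjective φ)
    (hker : RingHom.ker φ = Ideal.span {a}) :
    locusClass K (c a * x + c b) =
      torusClass K * locusClass K a + lefschetzClass K * locusClass K (φ b) :=
  locusClass_polynomial_linear a b φ hφ hker

theorem locusClass_x_add_c (p : R) : locusClass K (x + c p) = torusClass K * affineClass K R := by
  have h := locusClass_unit_linear (K := K) isUnit_one p
  rw [map_one, one_mul] at h
  exact h

theorem locusClass_c_mul (b : R) (f : PolyRing R) : locusClass K (c b * f) =
    locusClass K (map (IsScalarTower.toAlgHom K R (Localization.Away b)) f) :=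
  locusClass_mul (isAwayHom_map (isAwayHom_localization (K := K) b)) f

theorem locusClass_c_mul_x_add_c (b p : R) :
    locusClass K (c b * (x + c p)) = torusClass K * locusClass K b := by
  rw [locusClass_c_mul, map_add, map_c, map_x, locusClass_x_add_c]
  rfl

end PolyRing

/-! ### Loci of elementary symmetric polynomials. -/

open PolyRing

section
variable {K R : Type*} [Field K] [CommRing R] [Algebra K R]

/-- Evaluation of polynomials at `-p`, which presents the root locus of `x + p`. -/
def evalNeg (K : Type*) [Field K] {R : Type*} [CommRing R]
    [Algebra K R] (p : R) : PolyRing R →ₐ[K] R :=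
  ((aeval (-p)).restrictScalars K : R[X] →ₐ[K] R)

@[simp] theorem evalNeg_c (p r : R) : evalNeg K p (c r) = r := aeval_C _ _

@[simp] theorem evalNeg_x (p : R) : evalNeg K p x = -p := aeval_X _

theorem evalNeg_surjective (p : R) : Function.Surjective (evalNeg K p) := fun r => ⟨c r, by simp⟩

theorem ker_evalNeg (p : R) : RingHom.ker (evalNeg K p) = Ideal.span {x + c p} := by
  have h := ker_aeval (K := K) (-p)
  rw [C_neg, sub_neg_eq_add] at h
  exact h

theorem ker_evalNeg_unit {u : R} (hu : IsUnit u) (p : R) :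
    RingHom.ker (evalNeg K p) = Ideal.span {c u * (x + c p)} := by
  rw [ker_evalNeg, Ideal.span_singleton_mul_left_unit (hu.map c)]

/-- On `s x + p = 0` with `p x ≠ 0`, the coefficient `s` cannot vanish, so `x = -p / s` is
determined by the base. Projection therefore identifies this locus with `p s ≠ 0`. -/
theorem nonempty_algEquiv_quotient_linear (s p : R) {I : Ideal (PolyRing R)}
    (hI : I = Ideal.span {c s * x + c p}) {P M : Type*} [CommRing P] [CommRing M]
    [Algebra K P] [Algebra K M] [Algebra R M] [IsScalarTower K R M] [IsLocalization.Away (p * s) M]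
    [Algebra (PolyRing R ⧸ I) P] [IsScalarTower K (PolyRing R ⧸ I) P]
    [IsLocalization.Away (Ideal.Quotient.mkₐ K I (c p * x)) P] :
    Nonempty (M ≃ₐ[K] P) := by
  set φ := Ideal.Quotient.mkₐ K I with hφ
  let ι : (PolyRing R ⧸ I) →ₐ[K] P := IsScalarTower.toAlgHom K _ _
  let κ : R →ₐ[K] M := IsScalarTower.toAlgHom K _ _
  have hι : IsUnit (ι (φ (c p * x))) := IsLocalization.Away.algebraMap_isUnit _
  have hκ : IsUnit (κ (p * s)) := IsLocalization.Away.algebraMap_isUnit _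
  rw [map_mul, IsUnit.mul_iff] at hκ
  rw [map_mul, map_mul, IsUnit.mul_iff] at hι
  obtain ⟨hp, hs⟩ := hκ
  obtain ⟨t, ht⟩ := hs.exists_left_inv
  have ht' : IsUnit t := .of_mul_eq_one _ ht
  let f₀ : R →ₐ[K] P := (ι.comp φ).comp (CAlgHom : R →ₐ[K] R[X])
  have hf₀ : f₀ s * ι (φ x) + f₀ p = 0 := by
    change ι (φ (c s)) * _ + ι (φ (c p)) = 0
    rw [← map_mul, ← map_mul, ← map_add, ← map_add]
    rw [show φ (c s * x + c p) = 0 from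
      Ideal.Quotient.eq_zero_iff_mem.2 (hI ▸ Ideal.mem_span_singleton_self _), map_zero]
  have hf₀p : IsUnit (f₀ p) := hι.1
  -- The relation gives `s x = -p`, and `p` is a unit, hence so is `s`.
  have hf₀s : IsUnit (f₀ s) := by
    have : IsUnit (f₀ s * ι (φ x)) := by
      rw [eq_neg_of_add_eq_zero_left hf₀]; exact hf₀p.neg
    exact isUnit_of_mul_isUnit_left this
  -- The inverse map sends `x` to `-p / s`; here `t` is the inverse of `s`.
  let g₀ : PolyRing R →ₐ[K] M := (eval₂AlgHom κ (-(κ p * t)) fun _ => Commute.all _ _ : R[X] →ₐ[K] M)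
  have hg₀C (r : R) : g₀ (c r) = κ r := eval₂_C _ _
  have hg₀X : g₀ x = -(κ p * t) := eval₂_X _ _
  have hg₀ : ∀ y ∈ I, g₀ y = 0 := by
    rw [hI]
    intro y hy
    obtain ⟨z, rfl⟩ := Ideal.mem_span_singleton'.1 hy
    rw [map_mul, map_add, map_mul, hg₀C, hg₀C, hg₀X]
    linear_combination (-g₀ z * κ p) * ht
  let g₁ : (PolyRing R ⧸ I) →ₐ[K] M := Ideal.Quotient.liftₐ I g₀ hg₀
  have hg₁ (y : PolyRing R) : g₁ (φ y) = g₀ y := rfl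
  have hg₁' : IsUnit (g₁ (φ (c p * x))) := by
    rw [hg₁, map_mul, hg₀C, hg₀X]
    exact hp.mul (hp.mul ht').neg
  have hf₀' : IsUnit (f₀ (p * s)) := by rw [map_mul]; exact hf₀p.mul hf₀s
  let f : M →ₐ[K] P := IsLocalization.Away.liftAlgHom (p * s) hf₀'
  let g : P →ₐ[K] M := IsLocalization.Away.liftAlgHom (φ (c p * x)) hg₁'
  have hf (r : R) : f (κ r) = f₀ r := IsLocalization.Away.lift_eq (p * s) hf₀' r
  have hg (r) : g (ι r) = g₁ r := IsLocalization.Away.lift_eq (φ (c p * x)) hg₁' r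
  refine ⟨AlgEquiv.ofAlgHom f g ?_ ?_⟩
  · refine IsLocalization.algHom_ext (.powers (φ (c p * x))) ?_
    refine Ideal.Quotient.algHom_ext _ (PolyRing.algHom_ext (fun r => ?_) ?_)
    · change f (g (ι (φ (c r)))) = ι (φ (c r))
      rw [hg, hg₁, hg₀C, hf]
      rfl
    · change f (g (ι (φ x))) = ι (φ x)
      rw [hg, hg₁, hg₀X, map_neg, map_mul, hf]
      have h := congrArg f ht
      rw [map_mul, hf, map_one] at h
      linear_combination (-f t) * hf₀ + ι (φ x) * h
  · refine IsLocalization.algHom_ext (.powers (p * s)) ?_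
    ext r
    change g (f (κ r)) = κ r
    rw [hf]
    change g (ι (φ (c r))) = κ r
    rw [hg, hg₁, hg₀C]

end

section
variable {K : Type u} [Field K]
variable {R : Type u} [CommRing R] [Algebra K R] [Algebra.FiniteType K R]

theorem lefschetzClass_eq_torusClass_add_one : lefschetzClass K = torusClass K + 1 := by
  simp [torusClass]

/-- The second elementary symmetric polynomial in `p` and two variables. -/
def esymmTwo (p : R) : PolyRing (PolyRing R) := c (x + c p) * x + c (c p * x)

/-- The product of `p` and two variables. -/
def esymmThree (p : R) : PolyRing (PolyRing R) := c (c p * x) * x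

/-- The polynomial is linear in the last variable with coefficient `x + p`; on `x = -p` the constant
term becomes `-p²`, so it vanishes exactly with `p`. -/
theorem locusClass_esymmTwo (p : R) :
    locusClass K (esymmTwo p) = torusClass K ^ 2 * affineClass K R + lefschetzClass K * locusClass K p := by
  have h : evalNeg K p (c p * x) = -1 * (p * p) := by simp
  rw [esymmTwo, locusClass_linear (K := K) _ _ (evalNeg K p) (evalNeg_surjective p) (ker_evalNeg p),
    locusClass_x_add_c, h, locusClass_unit_mul isUnit_one.neg, locusClass_sq, pow_two, mul_assoc]

/-- For invertible `p` this is a family of lines with the two distinct points `0` and `-p` removed.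
-/
theorem locusClass_x_mul_x_add_c (p : R) :
    locusClass K (c p * (x * (x + c p))) = (torusClass K - 1) * locusClass K p := by
  rw [locusClass_c_mul]
  simp only [map_add, map_mul, map_c, map_x]
  set M := Localization.Away p
  set q := IsScalarTower.toAlgHom K R M p
  have hq : IsUnit q := IsLocalization.Away.algebraMap_isUnit p
  have h := locusClass_scissor (K := K) (x : PolyRing M) (x + c q) (evalNeg K q) (evalNeg_surjective q)
    (ker_evalNeg q)
  have h' : evalNeg K q x = -q := by simp
  rw [h', locusClass_of_isUnit hq.neg, locusClass_x] at h
  change _ = _ * affineClass K M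
  linear_combination -h

theorem locusClass_quotient_linear (s p : R) :
    locusClass K (Ideal.Quotient.mkₐ K (Ideal.span {c s * x + c p}) (c p * x)) =
      locusClass K (p * s) := 
  (affineClass_congr (nonempty_algEquiv_quotient_linear s p rfl).some).symm

end
end

/-! ### The polynomials of a bananified edge and the classes of their loci. -/

noncomputable section
open Polynomial

open PolyRing

section
variable {R : Type*} [CommRing R]

/-- The Symanzik polynomial of the `(1,3,1)`-bananification with one of the three parallel edges
deleted, where `A * t + B` is the polynomial of the original graph. The four variables are those
of an outer edge, a parallel edge, a second parallel edge and the other outer edge. -/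
def bananaDeletion (A B : R) : PolyRing (PolyRing (PolyRing (PolyRing R))) :=
  c (c (c (c A))) * ((c (c (c x)) + x) * (c x + c (c x)) +
      c x * c (c x)) +
    c (c (c (c B))) * (c x + c (c x))

/-- The Symanzik polynomial of the `(1,3,1)`-bananification with one of the three parallel edges
contracted, where `A * t + B` is the polynomial of the original graph. -/
def bananaContraction (A B : R) : PolyRing (PolyRing (PolyRing (PolyRing R))) :=
  (c (c (c (c A))) * (c (c (c x)) + x) + c (c (c (c B)))) *
    (c x * c (c x))

/-- The Symanzik polynomial of the `(1,3,1)`-bananification, where `A * t + B` is the polynomial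
of the original graph. -/
def bananaPolynomial (A B : R) : PolyRing (PolyRing (PolyRing (PolyRing (PolyRing R)))) :=
  c (bananaDeletion A B) * x + c (bananaContraction A B)

theorem bananaDeletion_eq (A B : R) : bananaDeletion A B =
    c (c (c (c A)) * (x + c x)) * x +
      c (c (c (c A) * c x + c (c B)) * (x + c x) +
        c (c (c A)) * c x * x) := by
  simp only [bananaDeletion, map_mul, map_add]
  generalize (c (c (c (c A))) : PolyRing (PolyRing (PolyRing (PolyRing R)))) = a 
  ring

variable {K : Type*} [Field K] [Algebra K R] {S : Type*} [CommRing S] [Algebra K S]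

/-- After exchanging the last outer variable with the last parallel one, the polynomial is visibly
linear in an outer variable, with coefficient `A e₂`, and the parallel variables enter only through
`e₂` and `e₃`. -/
theorem swap_bananaPolynomial (K : Type*) [CommRing K] {R : Type*} [CommRing R] [Algebra K R]
    (A B : R) : swap K (PolyRing (PolyRing (PolyRing R))) (bananaPolynomial A B) =
    c (c (c (c (c A))) * esymmTwo x) * x + 
      c (c (c (c (c A) * c x + c (c B))) * esymmTwo x +
        c (c (c (c A))) * esymmThree x) := by
  simp only [bananaPolynomial, bananaDeletion, bananaContraction, esymmTwo, esymmThree, map_mul,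
    map_add, swap_c_c, swap_c_x, swap_x]
  ring

theorem map_bananaDeletion (φ : R →ₐ[K] S) (A B : R) :
    map (map (map (map φ))) (bananaDeletion A B) =
      bananaDeletion (φ A) (φ B) := by
  simp [bananaDeletion]

theorem map_bananaPolynomial (φ : R →ₐ[K] S) (A B : R) :
    map (map (map (map (map φ)))) (bananaPolynomial A B) =
      bananaPolynomial (φ A) (φ B) := by
  simp [bananaPolynomial, bananaDeletion, bananaContraction]

theorem map_esymmTwo (φ : R →ₐ[K] S) (p : R) :
    map (map φ) (esymmTwo p) = esymmTwo (φ p) := by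
  simp [esymmTwo]

end

section
variable {K : Type u} [Field K]
variable {R : Type u} [CommRing R] [Algebra K R] [Algebra.FiniteType K R]

theorem locusClass_bananaDeletion_zero (B : R) : locusClass K (bananaDeletion 0 B) =
    torusClass K * lefschetzClass K ^ 3 * locusClass K B := by
  have h : bananaDeletion 0 B = c (c (c (c B)) * (x + c x)) := by
    simp [bananaDeletion]
  rw [h, locusClass_c, locusClass_c_mul_x_add_c, locusClass_c, locusClass_c]
  ring

/-- In the last outer variable the coefficient is `A` times the sum of the two parallel variables.
Where that sum vanishes, the constant term is `-A` times the square of one parallel variable. -/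
theorem locusClass_bananaDeletion_unit {A : R} (hA : IsUnit A) (B : R) :
    locusClass K (bananaDeletion A B) =
      torusClass K * lefschetzClass K ^ 2 * (torusClass K + 1) * affineClass K R := by
  have hA' : IsUnit (c (c A)) := (hA.map c).map c
  rw [bananaDeletion_eq, locusClass_linear (K := K) _ _ (evalNeg K x)
    (evalNeg_surjective x)
    (ker_evalNeg_unit hA' x), locusClass_unit_mul (hA'.map c), locusClass_x_add_c,
    affineClass_polyRing, affineClass_polyRing]
  have h : evalNeg K x (c (c (c A) * c x +
      c (c B)) * (x + c x) +
        c (c (c A)) * c x * x) =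
      -c (c A) * (x * x) := by
    simp [mul_assoc]
  rw [h, locusClass_unit_mul hA'.neg, locusClass_sq, locusClass_x,
    affineClass_polyRing]
  ring

/-- The polynomial reduces to `B e₂`: the two outer variables are free, and the conditions `B ≠ 0`
and `e₂ ≠ 0` are independent. -/
theorem locusClass_bananaPolynomial_zero (B : R) : locusClass K (bananaPolynomial 0 B) =
    torusClass K * lefschetzClass K ^ 4 * locusClass K B := by
  have h : swap K _ (bananaPolynomial 0 B) =
      c (c (c (c (c B))) * esymmTwo x) := by
    rw [swap_bananaPolynomial]; simp
  rw [locusClass_congr (swap K (PolyRing (PolyRing (PolyRing R)))), h,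
    locusClass_c, locusClass_mul (isAwayHom_map (isAwayHom_map (isAwayHom_map (isAwayHom_map
      (isAwayHom_localization (K := K) B))))),
    map_esymmTwo, map_x, locusClass_esymmTwo, locusClass_x,
    affineClass_polyRing, affineClass_polyRing,
    lefschetzClass_eq_torusClass_add_one, ← affineClass_of_isAwayHom (isAwayHom_localization B)]
  ring

/-- The equation `e₂ = 0` is `(x + p) y + p x = 0`. Where `e₃ ≠ 0` it can be solved for `y`, leaving
the condition `p x (x + p) ≠ 0`. -/
theorem locusClass_esymmThree (p : R) :
    locusClass K (Ideal.Quotient.mkₐ K (Ideal.span {esymmTwo p}) (esymmThree p)) =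
      (torusClass K - 1) * locusClass K p := by
  have h := locusClass_quotient_linear (K := K) (x + c p) (c p * x)
  rw [mul_assoc, locusClass_x_mul_x_add_c] at h
  exact h

/-- Linearity in an outer variable gives the stratum `e₂ ≠ 0` and the stratum `e₂ = 0`. On the
latter, `B` and the other outer variable drop out and the condition is `e₃ ≠ 0`. -/
theorem locusClass_bananaPolynomial_unit {A : R} (hA : IsUnit A) (B : R) :
    locusClass K (bananaPolynomial A B) =
      torusClass K * lefschetzClass K ^ 2 * (torusClass K ^ 2 + 2 * torusClass K - 1) *
        affineClass K R := by
  set A' := c (c A) with hA'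
  have hu : IsUnit A' := (hA.map c).map c
  have hu' : IsUnit (c (c A')) := (hu.map c).map c
  rw [locusClass_congr (swap K (PolyRing (PolyRing (PolyRing R)))),
    swap_bananaPolynomial, ← hA']
  set D := A' * c x + c (c B)
  set I := Ideal.span {esymmTwo (x : PolyRing (PolyRing R))} with hI
  have h0 : Ideal.Quotient.mkₐ K I (esymmTwo x) = 0 :=
    Ideal.Quotient.eq_zero_iff_mem.2 (Ideal.mem_span_singleton_self _)
  rw [locusClass_linear (K := K) _ _ (Ideal.Quotient.mkₐ K I) (Ideal.Quotient.mkₐ_surjective K I)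
      ((Ideal.Quotient.mkₐ_ker K I).trans (Ideal.span_singleton_mul_left_unit hu' _).symm),
    locusClass_unit_mul hu', map_add, map_mul, map_mul, h0, mul_zero, zero_add,
    locusClass_unit_mul (hu'.map _), locusClass_esymmThree, locusClass_esymmTwo,
    locusClass_x, affineClass_polyRing, affineClass_polyRing,
    lefschetzClass_eq_torusClass_add_one]
  ring

/-- The stratum `A = 0` contributes a multiple of `𝕃 [A = 0, B ≠ 0]`, which is precisely the term
that the linear formula for `A t + B` supplies; hence only the classes of `A t + B` and `A` remain,
without any division. The same elimination works for `locusClass_bananaPolynomial`. -/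
theorem locusClass_bananaDeletion (A B : R) : locusClass K (bananaDeletion A B) =
    torusClass K * (torusClass K + 1) ^ 2 * (locusClass K (c A * x + c B) + locusClass K A) := by
  have hs := Ideal.Quotient.mkₐ_surjective K (Ideal.span {A})
  have hk := Ideal.Quotient.mkₐ_ker K (Ideal.span {A})
  have hA : Ideal.Quotient.mkₐ K (Ideal.span {A}) A = 0 :=
    Ideal.Quotient.eq_zero_iff_mem.2 (Ideal.mem_span_singleton_self _)
  have h := isAwayHom_localization (K := K) A
  rw [locusClass_split (isAwayHom_map (isAwayHom_map (isAwayHom_map (isAwayHom_map h)))) _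
      (map_surjective (map_surjective (map_surjective (map_surjective hs))))
      (ker_map (ker_map (ker_map (ker_map hk)))),
    map_bananaDeletion, map_bananaDeletion, hA, locusClass_bananaDeletion_zero,
    locusClass_bananaDeletion_unit (A := IsScalarTower.toAlgHom K R _ A) h.isUnit,
    locusClass_linear (K := K) _ _ _ hs hk,
    affineClass_of_isAwayHom h, lefschetzClass_eq_torusClass_add_one]
  ring

theorem locusClass_bananaPolynomial (A B : R) : locusClass K (bananaPolynomial A B) =
    torusClass K * (torusClass K + 1) ^ 2 * ((torusClass K + 1) * locusClass K (c A * x + c B) +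
      (torusClass K - 1) * locusClass K A) := by
  have hs := Ideal.Quotient.mkₐ_surjective K (Ideal.span {A})
  have hk := Ideal.Quotient.mkₐ_ker K (Ideal.span {A})
  have hA : Ideal.Quotient.mkₐ K (Ideal.span {A}) A = 0 :=
    Ideal.Quotient.eq_zero_iff_mem.2 (Ideal.mem_span_singleton_self _)
  have h := isAwayHom_localization (K := K) A
  rw [locusClass_split
      (isAwayHom_map (isAwayHom_map (isAwayHom_map (isAwayHom_map (isAwayHom_map h))))) _
      (map_surjective (map_surjective (map_surjective (map_surjective (map_surjective hs)))))
      (ker_map (ker_map (ker_map (ker_map (ker_map hk))))),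
    map_bananaPolynomial, map_bananaPolynomial, hA, locusClass_bananaPolynomial_zero,
    locusClass_bananaPolynomial_unit (A := IsScalarTower.toAlgHom K R _ A) h.isUnit,
    locusClass_linear (K := K) _ _ _ hs hk,
    affineClass_of_isAwayHom h, lefschetzClass_eq_torusClass_add_one]
  ring

end
end

/-! ### Connectivity and the spanning forests of a bananification. -/

namespace Graph
variable {α : Type v} {β : Type u} {G H : Graph α β} {F F' : Set β} {e d : β} {u v w x y p q : α}

theorem ConnectedIn.refl (x : α) : G.ConnectedIn F x x := Relation.ReflTransGen.refl

theorem ConnectedIn.trans (h : G.ConnectedIn F u v) (h' : G.ConnectedIn F v w) :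
    G.ConnectedIn F u w := Relation.ReflTransGen.trans h h'

theorem ConnectedIn.symm (h : G.ConnectedIn F u v) : G.ConnectedIn F v u :=
  have : Std.Symm fun a b => ∃ d ∈ F, G.IsLink d a b := ⟨fun _ _ ⟨d, hd, h⟩ => ⟨d, hd, h.symm⟩⟩
  Relation.ReflTransGen.stdSymm.symm _ _ h

theorem IsLink.connectedIn (h : G.IsLink d u v) (hd : d ∈ F) : G.ConnectedIn F u v :=
  Relation.ReflTransGen.single ⟨d, hd, h⟩

/-- Connectivity is transported along a map of vertices under which links become connected. -/
theorem ConnectedIn.map (f : α → α)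
    (h : ∀ d ∈ F, ∀ u v, G.IsLink d u v → H.ConnectedIn F' (f u) (f v))
    (huv : G.ConnectedIn F u v) : H.ConnectedIn F' (f u) (f v) :=
  Relation.ReflTransGen.lift' f (fun u v ⟨d, hd, hl⟩ => h d hd u v hl) _ _ huv

theorem ConnectedIn.map_id
    (h : ∀ d ∈ F, ∀ u v, G.IsLink d u v → H.ConnectedIn F' u v)
    (huv : G.ConnectedIn F u v) : H.ConnectedIn F' u v :=
  huv.map id h

theorem ConnectedIn.mono (h : F ⊆ F') (huv : G.ConnectedIn F u v) : G.ConnectedIn F' u v :=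
  huv.map_id fun _ hd _ _ hl => hl.connectedIn (h hd)

theorem ConnectedIn.invariant (P : α → Prop)
    (h : ∀ d ∈ F, ∀ u v, G.IsLink d u v → P u → P v) (huv : G.ConnectedIn F u v) (hu : P u) :
    P v := by
  induction huv with
  | refl => exact hu
  | tail _ h' ih =>
    obtain ⟨d, hd, hl⟩ := h'
    exact h d hd _ _ hl ih

/-- The edge set `F` connects the ends of every edge of `G`. -/
def Spans (G : Graph α β) (F : Set β) : Prop :=
  ∀ d x y, G.IsLink d x y → G.ConnectedIn F x y

theorem Spans.mono (h : F ⊆ F') (hF : G.Spans F) : G.Spans F' :=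
  fun d x y hl => (hF d x y hl).mono h

theorem Spans.connectedIn (hF : G.Spans F) (h : G.ConnectedIn F' x y) : G.ConnectedIn F x y :=
  h.map_id fun d _ u v hl => hF d u v hl

theorem spans_iff : G.Spans F ↔ ∀ x y, G.ConnectedIn E(G) x y → G.ConnectedIn F x y :=
  ⟨fun h _ _ => h.connectedIn, fun h _ _ _ hl => h _ _ (hl.connectedIn hl.edge_mem)⟩

/-- Spanning forests are the minimal spanning edge sets. -/
theorem isSpanningForest_iff :
    G.IsSpanningForest F ↔ F ⊆ E(G) ∧ G.Spans F ∧ ∀ d ∈ F, ¬ G.Spans (F \ {d}) := by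
  unfold IsSpanningForest
  rw [← spans_iff]
  refine and_congr_right fun hF => and_congr_right fun hs => forall₂_congr fun d hd => ?_
  constructor
  · intro h hs'
    obtain ⟨x, y, hl⟩ := Graph.exists_isLink_of_mem_edgeSet (hF hd)
    exact h x y hl (hs' d x y hl)
  · intro h x y hl hc
    refine h fun d' x' y' hl' => (hs d' x' y' hl').map_id fun d'' hd'' u v hl'' => ?_
    by_cases hdd : d'' = d
    · subst hdd
      obtain ⟨rfl, rfl⟩ | ⟨rfl, rfl⟩ := hl''.eq_and_eq_or_eq_and_eq hl
      · exact hc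
      · exact hc.symm
    · exact hl''.connectedIn ⟨hd'', hdd⟩

theorem IsLink.sym2_eq (h : G.IsLink d u v) (h' : G.IsLink d x y) : s(u, v) = s(x, y) := by
  obtain ⟨rfl, rfl⟩ | ⟨rfl, rfl⟩ := h.eq_and_eq_or_eq_and_eq h'
  · rfl
  · exact Sym2.eq_swap

theorem ConnectedIn.of_sym2_eq (h : G.ConnectedIn F u v) (h' : s(x, y) = s(u, v)) :
    G.ConnectedIn F x y := by
  obtain ⟨rfl, rfl⟩ | ⟨rfl, rfl⟩ := Sym2.eq_iff.1 h'
  · exact h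
  · exact h.symm

/-- The data of a `(1,3,1)`-bananification of an edge. -/
structure BananaData (G H : Graph α β) (e : β) (x y p q : α) (a c b₀ b₁ b₂ : β) : Prop where
  isLink : G.IsLink e x y
  hp : p ∉ V(G)
  hq : q ∉ V(G)
  hpq : p ≠ q
  ha : a ∉ E(G)
  hc : c ∉ E(G)
  hb₀ : b₀ ∉ E(G)
  hb₁ : b₁ ∉ E(G)
  hb₂ : b₂ ∉ E(G)
  hac : a ≠ c
  ha₀ : a ≠ b₀
  ha₁ : a ≠ b₁
  ha₂ : a ≠ b₂
  hc₀ : c ≠ b₀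
  hc₁ : c ≠ b₁
  hc₂ : c ≠ b₂
  h₀₁ : b₀ ≠ b₁
  h₀₂ : b₀ ≠ b₂
  h₁₂ : b₁ ≠ b₂
  isLink_iff : ∀ d z w, H.IsLink d z w ↔
      (d ≠ e ∧ G.IsLink d z w) ∨
      (d = a ∧ s(z, w) = s(x, p)) ∨
      ((d = b₀ ∨ d = b₁ ∨ d = b₂) ∧ s(z, w) = s(p, q)) ∨
      (d = c ∧ s(z, w) = s(q, y))

/-- The three parallel edges play symmetric roles, so a transposition puts the marked one in the
last place. -/
theorem IsBananification.exists_data {f : β} (h : G.IsBananification e H f) :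
    ∃ x y p q a c b₀ b₁, BananaData G H e x y p q a c b₀ b₁ f := by
  obtain ⟨x, y, p, q, a, c, b, hl, ⟨hp, hq, hpq⟩, ⟨ha, hc, hb, hac, hba, hbc, hinj⟩, -, hH, i, rfl⟩ := h
  let σ := Equiv.swap i 2
  have hσ : σ 2 = i := Equiv.swap_apply_right _ _
  have hinj' : ∀ j k, j ≠ k → b (σ j) ≠ b (σ k) := fun j k hjk h => hjk (σ.injective (hinj h))
  refine ⟨x, y, p, q, a, c, b (σ 0), b (σ 1), ?_⟩
  rw [← hσ]
  refine ⟨hl, hp, hq, hpq, ha, hc, hb _, hb _, hb _, hac, (hba _).symm, (hba _).symm,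
    (hba _).symm, (hbc _).symm, (hbc _).symm, (hbc _).symm, hinj' _ _ (by decide),
    hinj' _ _ (by decide), hinj' _ _ (by decide), fun d z w => ?_⟩
  rw [hH, σ.surjective.exists]
  simp [Fin.exists_fin_succ]

namespace BananaData
variable {a c b₀ b₁ b₂ : β}

/-- The part of an edge set which consists of edges of `G` different from `e`. -/
def inner (G : Graph α β) (e : β) (F : Set β) : Set β := {d ∈ F | d ∈ E(G) ∧ d ≠ e}

/-- The new edges in `F` form a path between the ends of `e`. -/
def FullPattern (a c b₀ b₁ b₂ : β) (F : Set β) : Prop :=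
  a ∈ F ∧ c ∈ F ∧ ((b₀ ∈ F ∧ b₁ ∉ F ∧ b₂ ∉ F) ∨ (b₀ ∉ F ∧ b₁ ∈ F ∧ b₂ ∉ F) ∨
    (b₀ ∉ F ∧ b₁ ∉ F ∧ b₂ ∈ F))

/-- The new edges in `F` form a forest which joins each of the new vertices to exactly one of the
ends of `e`. -/
def CutPattern (a c b₀ b₁ b₂ : β) (F : Set β) : Prop :=
  (a ∈ F ∧ c ∈ F ∧ b₀ ∉ F ∧ b₁ ∉ F ∧ b₂ ∉ F) ∨
    (((a ∈ F ∧ c ∉ F) ∨ (a ∉ F ∧ c ∈ F)) ∧ ((b₀ ∈ F ∧ b₁ ∉ F ∧ b₂ ∉ F) ∨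
      (b₀ ∉ F ∧ b₁ ∈ F ∧ b₂ ∉ F) ∨ (b₀ ∉ F ∧ b₁ ∉ F ∧ b₂ ∈ F)))

theorem FullPattern.not_cutPattern (h : FullPattern a c b₀ b₁ b₂ F) :
    ¬ CutPattern a c b₀ b₁ b₂ F := by
  unfold FullPattern at h
  unfold CutPattern
  tauto

theorem inner_diff_of_notMem (hd : d ∉ E(G)) : inner G e (F \ {d}) = inner G e F := by
  ext d'
  simp only [inner, Set.mem_ofPred_eq, Set.mem_sdiff, Set.mem_singleton_iff]
  refine ⟨fun h => ⟨h.1.1, h.2⟩, fun h => ⟨⟨h.1, ?_⟩, h.2⟩⟩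
  rintro rfl
  exact hd h.2.1

theorem inner_diff : inner G e (F \ {d}) = inner G e F \ {d} := by
  ext d'
  simp only [inner, Set.mem_ofPred_eq, Set.mem_sdiff, Set.mem_singleton_iff]
  tauto

theorem forall_mem_not_or {P Q : Prop} {I : Set β} {s t : β → Prop} :
    (∀ d ∈ I, ¬ ((P ∧ s d) ∨ (Q ∧ t d))) ↔
      (P → ∀ d ∈ I, ¬ s d) ∧ (Q → ∀ d ∈ I, ¬ t d) := by
  grind

variable (D : BananaData G H e x y p q a c b₀ b₁ b₂)
include D

theorem link_a : H.IsLink a x p := (D.isLink_iff _ _ _).2 (by simp)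
theorem link_c : H.IsLink c q y := (D.isLink_iff _ _ _).2 (by simp)
theorem link_b₀ : H.IsLink b₀ p q := (D.isLink_iff _ _ _).2 (by simp)
theorem link_b₁ : H.IsLink b₁ p q := (D.isLink_iff _ _ _).2 (by simp)
theorem link_b₂ : H.IsLink b₂ p q := (D.isLink_iff _ _ _).2 (by simp)

theorem connectedIn_p_q (h : b₀ ∈ F ∨ b₁ ∈ F ∨ b₂ ∈ F) : H.ConnectedIn F p q := by
  obtain h | h | h := h
  · exact D.link_b₀.connectedIn h
  · exact D.link_b₁.connectedIn h
  · exact D.link_b₂.connectedIn h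

theorem link_of_ne (hd : d ≠ e) (h : G.IsLink d u v) : H.IsLink d u v :=
  (D.isLink_iff _ _ _).2 (.inl ⟨hd, h⟩)

theorem connectedIn_inner (h : G.ConnectedIn (inner G e F) u v) : H.ConnectedIn F u v :=
  h.map_id fun _ hd _ _ hl => (D.link_of_ne hd.2.2 hl).connectedIn hd.1

theorem connectedIn_insert (ha : a ∈ F) (hc : c ∈ F) (hb : b₀ ∈ F ∨ b₁ ∈ F ∨ b₂ ∈ F)
    (h : G.ConnectedIn (insert e (inner G e F)) u v) : H.ConnectedIn F u v := by
  refine h.map_id fun d hd u v hl => ?_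
  by_cases hde : d = e
  · subst hde
    refine ConnectedIn.of_sym2_eq ?_ (hl.sym2_eq D.isLink)
    exact ((D.link_a.connectedIn ha).trans (D.connectedIn_p_q hb)).trans (D.link_c.connectedIn hc)
  · have hd' := hd.resolve_left hde
    exact (D.link_of_ne hde hl).connectedIn hd'.1

theorem spans_of_full (ha : a ∈ F) (hc : c ∈ F) (hb : b₀ ∈ F ∨ b₁ ∈ F ∨ b₂ ∈ F)
    (h : G.Spans (insert e (inner G e F))) : H.Spans F := by
  intro d u v hl
  obtain ⟨-, hl⟩ | ⟨-, hs⟩ | ⟨-, hs⟩ | ⟨-, hs⟩ := (D.isLink_iff _ _ _).1 hl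
  · exact D.connectedIn_insert ha hc hb (h d u v hl)
  · exact (D.link_a.connectedIn ha).of_sym2_eq hs
  · exact (D.connectedIn_p_q hb).of_sym2_eq hs
  · exact (D.link_c.connectedIn hc).of_sym2_eq hs

theorem spans_of_two (h2 : (a ∈ F ∧ c ∈ F) ∨ ((a ∈ F ∨ c ∈ F) ∧ (b₀ ∈ F ∨ b₁ ∈ F ∨ b₂ ∈ F)))
    (h : G.Spans (inner G e F)) : H.Spans F := by
  have hxy : H.ConnectedIn F x y := D.connectedIn_inner (h e x y D.isLink)
  have hx : H.ConnectedIn F x p ∧ H.ConnectedIn F q y ∧ H.ConnectedIn F p q := by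
    obtain ⟨h1, h2⟩ | ⟨h1 | h1, h2⟩ := h2
    · have h1 := D.link_a.connectedIn h1
      have h2 := D.link_c.connectedIn h2
      exact ⟨h1, h2, (h1.symm.trans hxy).trans h2.symm⟩
    · have h1 := D.link_a.connectedIn h1
      have h2 := D.connectedIn_p_q h2
      exact ⟨h1, (h2.symm.trans h1.symm).trans hxy, h2⟩
    · have h1 := D.link_c.connectedIn h1
      have h2 := D.connectedIn_p_q h2
      exact ⟨(hxy.trans h1.symm).trans h2.symm, h1, h2⟩
  intro d u v hl
  obtain ⟨-, hl⟩ | ⟨-, hs⟩ | ⟨-, hs⟩ | ⟨-, hs⟩ := (D.isLink_iff _ _ _).1 hl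
  · exact D.connectedIn_inner (h d u v hl)
  · exact hx.1.of_sym2_eq hs
  · exact hx.2.2.of_sym2_eq hs
  · exact hx.2.1.of_sym2_eq hs

theorem two_of_spans (h : H.Spans F) :
    (a ∈ F ∧ c ∈ F) ∨ ((a ∈ F ∨ c ∈ F) ∧ (b₀ ∈ F ∨ b₁ ∈ F ∨ b₂ ∈ F)) := by
  have hxp : x ≠ p := fun h => D.hp (h ▸ D.isLink.left_mem)
  have hxq : x ≠ q := fun h => D.hq (h ▸ D.isLink.left_mem)
  have hyq : y ≠ q := fun h => D.hq (h ▸ D.isLink.right_mem)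
  have hpq := D.hpq
  -- A set `P` of new vertices that no edge of `F` leaves is closed under connection in `F`. As `F`
  -- joins `p` to `x` and `q` to `y`, such a set contains neither `p` nor `q`. Applied to `{p, q}`,
  -- `{q}` and `{p}`, this excludes every way of having too few new edges.
  have key (P : α → Prop) (hP : ∀ z ∈ V(G), ¬ P z) (ha : a ∈ F → ¬ P p) (hc : c ∈ F → ¬ P q)
      (hb : (b₀ ∈ F ∨ b₁ ∈ F ∨ b₂ ∈ F) → (P p ↔ P q)) : ¬ P p ∧ ¬ P q := by
    have hinv : ∀ d ∈ F, ∀ u v, H.IsLink d u v → P u → P v := by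
      intro d hd u v hl hu
      obtain ⟨-, hl⟩ | ⟨rfl, hs⟩ | ⟨hd', hs⟩ | ⟨rfl, hs⟩ := (D.isLink_iff _ _ _).1 hl
      · exact absurd hu (hP _ hl.left_mem)
      · obtain ⟨rfl, rfl⟩ | ⟨rfl, rfl⟩ := Sym2.eq_iff.1 hs
        · exact absurd hu (hP _ D.isLink.left_mem)
        · exact absurd hu (ha hd)
      · have hb := hb (by obtain rfl | rfl | rfl := hd' <;> simp [hd])
        obtain ⟨rfl, rfl⟩ | ⟨rfl, rfl⟩ := Sym2.eq_iff.1 hs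
        · exact hb.1 hu
        · exact hb.2 hu
      · obtain ⟨rfl, rfl⟩ | ⟨rfl, rfl⟩ := Sym2.eq_iff.1 hs
        · exact absurd hu (hc hd)
        · exact absurd hu (hP _ D.isLink.right_mem)
    exact ⟨fun hp => hP x D.isLink.left_mem ((h a x p D.link_a).symm.invariant P hinv hp),
      fun hq => hP y D.isLink.right_mem ((h c q y D.link_c).invariant P hinv hq)⟩
  have hV {z} (hz : z ∈ V(G)) : z ≠ p ∧ z ≠ q :=
    ⟨fun h => D.hp (h ▸ hz), fun h => D.hq (h ▸ hz)⟩
  by_contra hcon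
  by_cases hb : b₀ ∈ F ∨ b₁ ∈ F ∨ b₂ ∈ F
  · have := key (fun z => z = p ∨ z = q) (fun z hz => by simp [hV hz]) (by tauto) (by tauto)
      (by tauto)
    tauto
  · by_cases ha : a ∈ F
    · have := key (fun z => z = q) (fun z hz => by simp [hV hz]) (by tauto) (by tauto) (by tauto)
      tauto
    · have := key (fun z => z = p) (fun z hz => by simp [hV hz]) (by tauto) (by tauto) (by tauto)
      tauto

open scoped Classical in
/-- The contraction of the new part of the bananification onto the ends of the edge `e`. -/
noncomputable def retract (x y p q : α) (a c : β) (F : Set β) (z : α) : α :=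
  -- Each new vertex goes to an end of `e` to which `F` attaches it through the string. If `F`
  -- contains neither outer edge the choice is immaterial, but `p` and `q` must go to the same end.
  if z = q then (if c ∈ F then y else if a ∈ F then x else y) else
    if z = p then (if a ∈ F then x else y) else z

theorem retract_of_mem {z : α} (hz : z ∈ V(G)) : retract x y p q a c F z = z := by
  have hp : z ≠ p := fun h => D.hp (h ▸ hz)
  have hq : z ≠ q := fun h => D.hq (h ▸ hz)
  simp [retract, hp, hq]

/-- Under the retraction every new edge in `F` collapses to a vertex, except a parallel edge when
both outer edges are in `F`; that one becomes `e`. -/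
theorem connectedIn_retract (hF' : inner G e F ⊆ F')
    (he : a ∈ F → c ∈ F → (b₀ ∈ F ∨ b₁ ∈ F ∨ b₂ ∈ F) → e ∈ F') (h : H.ConnectedIn F u v) :
    G.ConnectedIn F' (retract x y p q a c F u) (retract x y p q a c F v) := by
  classical
  refine h.map _ fun d hd u v hl => ?_
  have hx := D.retract_of_mem (F := F) D.isLink.left_mem
  have hy := D.retract_of_mem (F := F) D.isLink.right_mem
  have hp : retract x y p q a c F p = if a ∈ F then x else y := by simp [retract, D.hpq]
  have hq : retract x y p q a c F q = if c ∈ F then y else if a ∈ F then x else y := by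
    simp [retract]
  obtain ⟨hde, hl⟩ | ⟨rfl, hs⟩ | ⟨hd', hs⟩ | ⟨rfl, hs⟩ := (D.isLink_iff _ _ _).1 hl
  · rw [D.retract_of_mem hl.left_mem, D.retract_of_mem hl.right_mem]
    exact hl.connectedIn (hF' ⟨hd, hl.edge_mem, hde⟩)
  · have h1 : G.ConnectedIn F' (retract x y p q d c F x) (retract x y p q d c F p) := by
      rw [hx, hp, if_pos hd]; exact .refl _
    obtain ⟨rfl, rfl⟩ | ⟨rfl, rfl⟩ := Sym2.eq_iff.1 hs
    exacts [h1, h1.symm]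
  · have h1 : G.ConnectedIn F' (retract x y p q a c F p) (retract x y p q a c F q) := by
      rw [hp, hq]
      by_cases ha : a ∈ F <;> by_cases hc : c ∈ F <;> simp only [ha, hc, if_true, if_false] <;>
        try exact .refl _
      exact D.isLink.connectedIn (he ha hc (by obtain rfl | rfl | rfl := hd' <;> simp [hd]))
    obtain ⟨rfl, rfl⟩ | ⟨rfl, rfl⟩ := Sym2.eq_iff.1 hs
    exacts [h1, h1.symm]
  · have h1 : G.ConnectedIn F' (retract x y p q a d F q) (retract x y p q a d F y) := by
      rw [hy, hq, if_pos hd]; exact .refl _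
    obtain ⟨rfl, rfl⟩ | ⟨rfl, rfl⟩ := Sym2.eq_iff.1 hs
    exacts [h1, h1.symm]

theorem spans_of_spans (hF' : inner G e F ⊆ F')
    (he : a ∈ F → c ∈ F → (b₀ ∈ F ∨ b₁ ∈ F ∨ b₂ ∈ F) → e ∈ F') (h : H.Spans F) : G.Spans F' := by
  intro d u v hl
  rw [← D.retract_of_mem (F := F) hl.left_mem, ← D.retract_of_mem (F := F) hl.right_mem]
  refine D.connectedIn_retract hF' he ?_
  by_cases hde : d = e
  · subst hde
    refine ConnectedIn.of_sym2_eq ?_ (hl.sym2_eq D.isLink)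
    -- The edge `e` is missing in `H`; its ends are joined through `p` and `q`.
    exact ((h _ _ _ D.link_a).trans (h _ _ _ D.link_b₀)).trans (h _ _ _ D.link_c)
  · exact h d u v (D.link_of_ne hde hl)

/-- A complete path along the string replaces `e`. Without one, the old edges in `F` must already
join `x` and `y`, and attaching both `p` and `q` takes two of the three steps of the string. -/
theorem spans_iff : H.Spans F ↔
    ((a ∈ F ∧ c ∈ F ∧ (b₀ ∈ F ∨ b₁ ∈ F ∨ b₂ ∈ F)) ∧ G.Spans (insert e (inner G e F))) ∨
    (((a ∈ F ∧ c ∈ F) ∨ ((a ∈ F ∨ c ∈ F) ∧ (b₀ ∈ F ∨ b₁ ∈ F ∨ b₂ ∈ F))) ∧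
      G.Spans (inner G e F)) := by
  constructor
  · intro h
    by_cases hfull : a ∈ F ∧ c ∈ F ∧ (b₀ ∈ F ∨ b₁ ∈ F ∨ b₂ ∈ F)
    · exact .inl ⟨hfull, D.spans_of_spans (Set.subset_insert _ _) (fun _ _ _ => .inl rfl) h⟩
    · exact .inr ⟨D.two_of_spans h, D.spans_of_spans subset_rfl (by tauto) h⟩
  · rintro (⟨⟨ha, hc, hb⟩, h⟩ | ⟨h2, h⟩)
    · exact D.spans_of_full ha hc hb h
    · exact D.spans_of_two h2 h

theorem forall_mem_iff (hF : F ⊆ E(H)) (P : β → Prop) : (∀ d ∈ F, P d) ↔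
    (a ∈ F → P a) ∧ (c ∈ F → P c) ∧ (b₀ ∈ F → P b₀) ∧ (b₁ ∈ F → P b₁) ∧ (b₂ ∈ F → P b₂) ∧
      ∀ d ∈ inner G e F, P d := by
  refine ⟨fun h => ⟨h a, h c, h b₀, h b₁, h b₂, fun d hd => h d hd.1⟩, ?_⟩
  rintro ⟨ha, hc, h₀, h₁, h₂, hi⟩ d hd
  obtain ⟨u, v, hl⟩ := Graph.exists_isLink_of_mem_edgeSet (hF hd)
  obtain ⟨hde, hl⟩ | ⟨rfl, -⟩ | ⟨rfl | rfl | rfl, -⟩ | ⟨rfl, -⟩ := (D.isLink_iff _ _ _).1 hl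
  · exact hi d ⟨hd, hl.edge_mem, hde⟩
  · exact ha hd
  · exact h₀ hd
  · exact h₁ hd
  · exact h₂ hd
  · exact hc hd

/-- The spanning forests of a bananification. -/
theorem isSpanningForest_iff (hF : F ⊆ E(H)) : H.IsSpanningForest F ↔
    (FullPattern a c b₀ b₁ b₂ F ∧ G.IsSpanningForest (insert e (inner G e F))) ∨
    (CutPattern a c b₀ b₁ b₂ F ∧ G.IsSpanningForest (inner G e F)) := by
  unfold FullPattern CutPattern
  have hi : inner G e F ⊆ E(G) := fun d hd => hd.2.1
  have hi' : insert e (inner G e F) ⊆ E(G) := Set.insert_subset D.isLink.edge_mem hi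
  have he : e ∉ inner G e F := fun h => h.2.2 rfl
  have h1 : G.IsSpanningForest (insert e (inner G e F)) ↔ G.Spans (insert e (inner G e F)) ∧
      ¬ G.Spans (inner G e F) ∧ ∀ d ∈ inner G e F, ¬ G.Spans (insert e (inner G e F \ {d})) := by
    rw [Graph.isSpanningForest_iff, Set.forall_mem_insert, Set.insert_sdiff_self_of_notMem he]
    simp only [hi', true_and]
    refine and_congr_right fun _ => and_congr_right fun _ => forall₂_congr fun d hd => ?_
    rw [Set.insert_sdiff_of_notMem]
    exact fun h => hd.2.2 h.symm
  have h0 : G.IsSpanningForest (inner G e F) ↔ G.Spans (inner G e F) ∧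
      ∀ d ∈ inner G e F, ¬ G.Spans (inner G e F \ {d}) := by
    rw [Graph.isSpanningForest_iff]
    simp only [hi, true_and]
  have hmono : G.Spans (inner G e F) → G.Spans (insert e (inner G e F)) :=
    Spans.mono (Set.subset_insert _ _)
  have hmono' (d) : G.Spans (inner G e F \ {d}) → G.Spans (insert e (inner G e F \ {d})) :=
    Spans.mono (Set.subset_insert _ _)
  have hne (d) (hd : d ∈ inner G e F) : a ≠ d ∧ c ≠ d ∧ b₀ ≠ d ∧ b₁ ≠ d ∧ b₂ ≠ d :=
    ⟨fun h => D.ha (h ▸ hd.2.1), fun h => D.hc (h ▸ hd.2.1), fun h => D.hb₀ (h ▸ hd.2.1),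
      fun h => D.hb₁ (h ▸ hd.2.1), fun h => D.hb₂ (h ▸ hd.2.1)⟩
  have hlast : (∀ d ∈ inner G e F, ¬ H.Spans (F \ {d})) ↔
      (a ∈ F ∧ c ∈ F ∧ (b₀ ∈ F ∨ b₁ ∈ F ∨ b₂ ∈ F) →
        ∀ d ∈ inner G e F, ¬ G.Spans (insert e (inner G e F \ {d}))) ∧
      ((a ∈ F ∧ c ∈ F) ∨ ((a ∈ F ∨ c ∈ F) ∧ (b₀ ∈ F ∨ b₁ ∈ F ∨ b₂ ∈ F)) →
        ∀ d ∈ inner G e F, ¬ G.Spans (inner G e F \ {d})) := by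
    rw [← forall_mem_not_or]
    refine forall₂_congr fun d hd => ?_
    obtain ⟨n1, n2, n3, n4, n5⟩ := hne d hd
    rw [D.spans_iff, inner_diff]
    simp only [Set.mem_sdiff, Set.mem_singleton_iff, n1, n2, n3, n4, n5, not_false_iff, and_true]
  rw [Graph.isSpanningForest_iff, D.forall_mem_iff hF, hlast, h1, h0]
  simp only [D.spans_iff, inner_diff_of_notMem D.ha, inner_diff_of_notMem D.hc,
    inner_diff_of_notMem D.hb₀, inner_diff_of_notMem D.hb₁, inner_diff_of_notMem D.hb₂,
    Set.mem_sdiff, Set.mem_singleton_iff, hF, true_and, D.hac, D.hac.symm, D.ha₀, D.ha₁, D.ha₂,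
    D.ha₀.symm, D.ha₁.symm, D.ha₂.symm, D.hc₀, D.hc₁, D.hc₂, D.hc₀.symm, D.hc₁.symm, D.hc₂.symm,
    D.h₀₁, D.h₀₂, D.h₁₂, D.h₀₁.symm, D.h₀₂.symm, D.h₁₂.symm, not_true_eq_false, not_false_eq_true,
    and_true, and_false]
  -- Besides the memberships of the five new edges, only four truth values now matter: whether the
  -- old part spans with or without `e`, and whether each of these is minimal in the old edges.
  -- Monotonicity of spanning gives the only relations needed, so the claim becomes a finite
  -- propositional check.
  have hN : (∀ d ∈ inner G e F, ¬ G.Spans (insert e (inner G e F \ {d}))) →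
      ∀ d ∈ inner G e F, ¬ G.Spans (inner G e F \ {d}) :=
    fun h d hd h' => h d hd (hmono' d h')
  clear h1 h0 hlast hne hmono' hi hi' he hF D
  generalize (∀ d ∈ inner G e F, ¬ G.Spans (inner G e F \ {d})) = N0 at *
  generalize (∀ d ∈ inner G e F, ¬ G.Spans (insert e (inner G e F \ {d}))) = N1 at *
  generalize G.Spans (inner G e F) = S0 at *
  generalize G.Spans (insert e (inner G e F)) = S1 at *
  by_cases ha : a ∈ F <;> by_cases hc : c ∈ F <;> by_cases hb₀ : b₀ ∈ F <;>
    by_cases hb₁ : b₁ ∈ F <;> by_cases hb₂ : b₂ ∈ F <;>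
    simp only [ha, hc, hb₀, hb₁, hb₂, true_and, and_true, false_and, and_false, or_true,
      or_false, false_or, not_true_eq_false, not_false_eq_true, true_imp_iff, false_imp_iff] <;>
    clear ha hc hb₀ hb₁ hb₂ <;> tauto

end BananaData
end Graph

/-! ### Forest polynomials and their expansion in the new edges. -/

noncomputable section

open scoped Classical in
/-- The sum over the finite sets `F` with a property `Q` of the product of the variables which are
not in `F`. -/
def basisPolynomial (K : Type*) [CommRing K] {σ : Type*} [Finite σ] (Q : Finset σ → Prop) :
    MvPolynomial σ K :=
  letI : Fintype σ := Fintype.ofFinite σ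
  ∑ F ∈ Finset.univ.filter Q, ∏ d ∈ Fᶜ, MvPolynomial.X d

section
variable {K : Type*} [CommRing K] {σ τ : Type*} [Finite σ] [Finite τ]

theorem basisPolynomial_eq [Fintype σ] [DecidableEq σ] (Q : Finset σ → Prop) [DecidablePred Q] :
    basisPolynomial K Q = ∑ F ∈ Finset.univ.filter Q, ∏ d ∈ Fᶜ, MvPolynomial.X d := by
  unfold basisPolynomial
  convert rfl

theorem basisPolynomial_false : basisPolynomial K (fun _ : Finset σ => False) = 0 := by
  simp [basisPolynomial]

theorem rename_basisPolynomial (e : σ ≃ τ) (Q : Finset τ → Prop) :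
    MvPolynomial.rename e (basisPolynomial K fun F => Q (F.map e.toEmbedding)) =
      basisPolynomial K Q := by
  classical
  let _ := Fintype.ofFinite σ
  let _ := Fintype.ofFinite τ
  rw [basisPolynomial_eq, basisPolynomial_eq, map_sum]
  refine Finset.sum_equiv e.finsetCongr (by simp) fun F _ => ?_
  rw [map_prod]
  refine Finset.prod_equiv e (by simp) (by simp)

/-- Sets avoiding `none` contribute its variable as a factor; sets containing it contribute to the
constant term. -/
theorem basisPolynomial_option (Q : Finset (Option σ) → Prop) :
    MvPolynomial.optionEquivLeft K σ (basisPolynomial K Q) =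
      Polynomial.C (basisPolynomial K fun F => Q (F.map .some)) * Polynomial.X +
        Polynomial.C (basisPolynomial K fun F => Q (Finset.insertNone F)) := by
  classical
  let _ := Fintype.ofFinite σ
  rw [basisPolynomial_eq, basisPolynomial_eq, basisPolynomial_eq, map_sum,
    ← Finset.sum_filter_not_add_sum_filter _ (fun F => none ∈ F), map_sum, map_sum, Finset.sum_mul]
  congr 1
  · refine Finset.sum_nbij' Finset.eraseNone (fun F => F.map .some) ?_ ?_ ?_ ?_ ?_
    · intro F hF
      simp only [Finset.mem_filter, Finset.mem_univ, true_and] at hF ⊢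
      rw [Finset.map_some_eraseNone, Finset.erase_eq_of_notMem hF.2]
      exact hF.1
    · intro F hF
      simpa using hF
    · intro F hF
      simp only [Finset.mem_filter, Finset.mem_univ, true_and] at hF
      rw [Finset.map_some_eraseNone, Finset.erase_eq_of_notMem hF.2]
    · intro F hF
      simp
    · intro F hF
      simp only [Finset.mem_filter, Finset.mem_univ, true_and] at hF
      have : Fᶜ = Finset.insertNone (Finset.eraseNone F)ᶜ := by
        ext (_ | d) <;> simp [hF.2]
      rw [this, map_prod, map_prod]
      simp [Finset.insertNone, mul_comm]
  · refine Finset.sum_nbij' Finset.eraseNone (fun F => Finset.insertNone F) ?_ ?_ ?_ ?_ ?_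
    · intro F hF
      simp only [Finset.mem_filter, Finset.mem_univ, true_and] at hF ⊢
      rw [Finset.insertNone_eraseNone, Finset.insert_eq_of_mem hF.2]
      exact hF.1
    · intro F hF
      simpa using hF
    · intro F hF
      simp only [Finset.mem_filter, Finset.mem_univ, true_and] at hF
      rw [Finset.insertNone_eraseNone, Finset.insert_eq_of_mem hF.2]
    · intro F hF
      simp
    · intro F hF
      simp only [Finset.mem_filter, Finset.mem_univ, true_and] at hF
      have : Fᶜ = (Finset.eraseNone F)ᶜ.map .some := by
        ext (_ | d) <;> simp [hF.2]
      rw [this, map_prod, map_prod]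
      simp
end

open PolyRing

/-- The polynomial ring in the variables `Option σ` as an iterated polynomial ring. -/
def optionEquiv (K : Type*) [CommRing K] (σ : Type*) :
    MvPolynomial (Option σ) K ≃ₐ[K] PolyRing (MvPolynomial σ K) :=
  MvPolynomial.optionEquivLeft K σ

namespace PolyRing

/-- Isomorphic coefficient rings have isomorphic polynomial rings. -/
def congr {K R S : Type*} [CommRing K] [CommRing R] [Algebra K R] [CommRing S] [Algebra K S]
    (e : R ≃ₐ[K] S) : PolyRing R ≃ₐ[K] PolyRing S :=
  Polynomial.mapAlgEquiv e

section
variable {K R S : Type*} [CommRing K] [CommRing R] [Algebra K R] [CommRing S] [Algebra K S]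

@[simp] theorem congr_c (e : R ≃ₐ[K] S) (r : R) : congr e (c r) = c (e r) := Polynomial.map_C _

@[simp] theorem congr_x (e : R ≃ₐ[K] S) : congr e x = x := Polynomial.map_X _

end
end PolyRing

namespace Graph
variable (K : Type*) [CommRing K] {α : Type v} {β : Type*} (G H : Graph α β)

/-- The sum over the spanning forests which consist of the edges in `N` and some of the edges
`ι i`, of the product of the variables of the other edges `ι i`. -/
def forestPolynomial {σ : Type*} [Finite σ] (ι : σ → β) (N : Set β) : MvPolynomial σ K :=
  basisPolynomial K fun F => G.IsSpanningForest (N ∪ ι '' F)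

variable {K G H}

theorem rename_forestPolynomial {σ τ : Type*} [Finite σ] [Finite τ] (e : σ ≃ τ) (ι : τ → β)
    (N : Set β) :
    MvPolynomial.rename e (G.forestPolynomial K (ι ∘ e) N) = G.forestPolynomial K ι N := by
  rw [forestPolynomial, forestPolynomial, ← rename_basisPolynomial e]
  simp only [Finset.coe_map, Set.image_comp, Equiv.coe_toEmbedding]

theorem optionEquiv_forestPolynomial {σ : Type*} [Finite σ] (ι : Option σ → β) (N : Set β) :
    optionEquiv K σ (G.forestPolynomial K ι N) =
      c (G.forestPolynomial K (fun i => ι (some i)) N) * x +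
        c (G.forestPolynomial K (fun i => ι (some i)) (insert (ι none) N)) := by
  refine (basisPolynomial_option _).trans ?_
  unfold forestPolynomial
  simp only [Finset.coe_map, ← Set.image_comp]
  have (F : Finset σ) : N ∪ ι '' (Finset.insertNone F : Finset (Option σ)) =
      insert (ι none) N ∪ (fun i => ι (some i)) '' F := by
    ext d
    simp only [Set.mem_union, Set.mem_image, Set.mem_insert_iff, Finset.mem_coe, Option.exists,
      Finset.none_mem_insertNone, Finset.some_mem_insertNone, true_and]
    tauto
  simp only [this]
  rfl

variable {e : β} {x y p q : α} {a c b₀ b₁ b₂ : β}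

namespace BananaData
/-- The edges of a bananification without one of the three parallel edges. -/
def edgeMap (G : Graph α β) (e a c b₀ b₁ : β) :
    Option (Option (Option (Option ↥(E(G) \ {e})))) → β
  | none => c
  | some none => b₁
  | some (some none) => b₀
  | some (some (some none)) => a
  | some (some (some (some d))) => d

variable (D : BananaData G H e x y p q a c b₀ b₁ b₂)
include D

/-- `N` consists of new edges and `F` of old ones, so the pattern is read off from `N` and the inner
part is `F`. -/
theorem isSpanningForest_union_iff {N : Set β} (hN : N ⊆ {a, c, b₀, b₁, b₂})
    (F : Finset ↥(E(G) \ {e})) :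
    H.IsSpanningForest (N ∪ (↑) '' (F : Set ↥(E(G) \ {e}))) ↔
      (FullPattern a c b₀ b₁ b₂ N ∧
        G.IsSpanningForest ({e} ∪ (↑) '' (F : Set ↥(E(G) \ {e})))) ∨
      (CutPattern a c b₀ b₁ b₂ N ∧
        G.IsSpanningForest (∅ ∪ (↑) '' (F : Set ↥(E(G) \ {e})))) := by
  have hmem (d) (hd : d ∉ E(G)) :
      d ∈ N ∪ (↑) '' (F : Set ↥(E(G) \ {e})) ↔ d ∈ N := by
    simp [hd]
  have hN' (d) (hd : d ∈ N) : d ∉ E(G) ∧ d ∈ E(H) := by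
    obtain rfl | rfl | rfl | rfl | rfl := hN hd
    exacts [⟨D.ha, D.link_a.edge_mem⟩, ⟨D.hc, D.link_c.edge_mem⟩, ⟨D.hb₀, D.link_b₀.edge_mem⟩,
      ⟨D.hb₁, D.link_b₁.edge_mem⟩, ⟨D.hb₂, D.link_b₂.edge_mem⟩]
  have hinner : inner G e (N ∪ (↑) '' (F : Set ↥(E(G) \ {e}))) =
      (↑) '' (F : Set ↥(E(G) \ {e})) := by
    ext d
    constructor
    · rintro ⟨hd | hd, hd', -⟩
      · exact absurd hd' (hN' d hd).1
      · exact hd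
    · intro hd
      refine ⟨.inr hd, ?_⟩
      obtain ⟨d, -, rfl⟩ := hd
      exact d.2
  have hsub : N ∪ (↑) '' (F : Set ↥(E(G) \ {e})) ⊆ E(H) := by
    rintro d (hd | ⟨d, -, rfl⟩)
    · exact (hN' d hd).2
    · obtain ⟨u, v, hl⟩ := Graph.exists_isLink_of_mem_edgeSet d.2.1
      exact (D.link_of_ne d.2.2 hl).edge_mem
  rw [D.isSpanningForest_iff hsub, hinner, Set.empty_union, Set.singleton_union]
  unfold FullPattern CutPattern
  simp only [hmem _ D.ha, hmem _ D.hc, hmem _ D.hb₀, hmem _ D.hb₁, hmem _ D.hb₂]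

variable [Finite E(G)]

open scoped Classical in
theorem forestPolynomial_eq_ite {N : Set β} (hN : N ⊆ {a, c, b₀, b₁, b₂}) :
    H.forestPolynomial K (fun d : ↥(E(G) \ {e}) => (d : β)) N =
      if FullPattern a c b₀ b₁ b₂ N then G.forestPolynomial K (↑) {e} else
        if CutPattern a c b₀ b₁ b₂ N then G.forestPolynomial K (↑) ∅ else 0 := by
  unfold forestPolynomial
  simp only [D.isSpanningForest_union_iff hN]
  split_ifs with h h'
  · simp only [h, h.not_cutPattern, true_and, false_and, or_false]
  · simp only [h, h', true_and, false_and, false_or]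
  · simp only [h, h', false_and, false_or]
    exact basisPolynomial_false

/-- The iterated polynomial ring whose variables are the edges of a bananification without one of
the three parallel edges. -/
def edgeEquiv (K : Type*) [CommRing K] (σ : Type*) :
    MvPolynomial (Option (Option (Option (Option σ)))) K ≃ₐ[K]
      PolyRing (PolyRing (PolyRing (PolyRing (MvPolynomial σ K)))) :=
  (optionEquiv K _).trans (PolyRing.congr ((optionEquiv K _).trans (PolyRing.congr
    ((optionEquiv K _).trans (PolyRing.congr (optionEquiv K σ))))))

theorem edgeEquiv_deletion :
    edgeEquiv K _ (H.forestPolynomial K (edgeMap G e a c b₀ b₁) ∅) =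
      bananaDeletion (G.forestPolynomial K ((↑) : ↥(E(G) \ {e}) → β) ∅)
        (G.forestPolynomial K (↑) {e}) := by
  simp only [edgeEquiv, AlgEquiv.trans_apply, optionEquiv_forestPolynomial, map_add, map_mul,
    congr_c, congr_x, edgeMap]
  -- Each subset of the four remaining new edges is a full pattern, a cut pattern or neither, so its
  -- coefficient is `B`, `A` or `0`.
  simp (disch := simp [Set.insert_subset_iff]) only [D.forestPolynomial_eq_ite]
  simp only [FullPattern, CutPattern, Set.mem_insert_iff,
    Set.mem_empty_iff_false, D.hac, D.hac.symm, D.ha₀, D.ha₁,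
    D.ha₀.symm, D.ha₁.symm, D.ha₂.symm, D.hc₀, D.hc₁, D.hc₀.symm, D.hc₁.symm, D.hc₂.symm,
    D.h₀₁, D.h₀₁.symm, D.h₀₂.symm, D.h₁₂.symm, or_true, or_false,
    and_true, and_false, not_true_eq_false, not_false_eq_true, if_true,
    if_false, map_zero]
  unfold bananaDeletion
  ring

theorem edgeEquiv_contraction :
    edgeEquiv K _ (H.forestPolynomial K (edgeMap G e a c b₀ b₁) {b₂}) =
      bananaContraction (G.forestPolynomial K ((↑) : ↥(E(G) \ {e}) → β) ∅)
        (G.forestPolynomial K (↑) {e}) := by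
  simp only [edgeEquiv, AlgEquiv.trans_apply, optionEquiv_forestPolynomial, map_add, map_mul,
    congr_c, congr_x, edgeMap]
  simp (disch := simp [Set.insert_subset_iff]) only [D.forestPolynomial_eq_ite]
  simp only [FullPattern, CutPattern, Set.mem_insert_iff, Set.mem_singleton_iff,
    D.hac, D.hac.symm, D.ha₀, D.ha₁, D.ha₂,
    D.ha₀.symm, D.ha₁.symm, D.ha₂.symm, D.hc₀, D.hc₁, D.hc₂, D.hc₀.symm, D.hc₁.symm, D.hc₂.symm,
    D.h₀₁, D.h₀₂, D.h₁₂, D.h₀₁.symm, D.h₀₂.symm, D.h₁₂.symm, or_true, or_false,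
    and_true, and_false, not_true_eq_false, not_false_eq_true, if_true,
    if_false, map_zero]
  unfold bananaContraction
  ring

end BananaData
end Graph
end

/-! ### Grothendieck classes of graphs and the recurrence. -/

noncomputable section

open PolyRing

namespace Graph

section
variable {K : Type*} [CommRing K] {α : Type v} {β : Type*} {G H : Graph α β}

/-- A single isomorphism must serve all `N`, because the coefficient and the constant term in a
chosen edge variable are transported together. -/
theorem exists_algEquiv_forestPolynomial {σ : Type*} [Finite σ] {ι : σ → β}
    (hι : Function.Injective ι) {S : Set β} [Finite S] (hS : S = Set.range ι) :
    ∃ θ : MvPolynomial S K ≃ₐ[K] MvPolynomial σ K, ∀ (G : Graph α β) (N : Set β),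
      θ (G.forestPolynomial K (↑) N) = G.forestPolynomial K ι N := by
  subst hS
  refine ⟨(MvPolynomial.renameEquiv K (Equiv.ofInjective ι hι)).symm, fun G N => ?_⟩
  rw [AlgEquiv.symm_apply_eq]
  exact (rename_forestPolynomial (Equiv.ofInjective ι hι) _ N).symm

theorem forestPolynomial_congr {σ : Type*} [Finite σ] {ι : σ → β} {N : Set β}
    (h : ∀ F : Finset σ, G.IsSpanningForest (N ∪ ι '' F) ↔ H.IsSpanningForest (N ∪ ι '' F)) :
    G.forestPolynomial K ι N = H.forestPolynomial K ι N := by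
  unfold forestPolynomial
  simp only [h]

end

section
variable {α : Type v} {β : Type u} {G : Graph α β} {e : β}

theorem not_spans_of_isBridge (he : G.IsBridge e) {F : Set β} (hF : F ⊆ E(G) \ {e}) :
    ¬ G.Spans F := by
  obtain ⟨x, y, hl, h⟩ := he
  exact fun hs => h ((hs e x y hl).mono hF)

/-- The ends of a non-bridge are joined in `G ∖ e`, so a set connecting the ends of all other edges
also connects the ends of `e`. -/
theorem spans_deleteEdges_iff (he : ¬ G.IsBridge e) {F : Set β} (hF : F ⊆ E(G) \ {e}) :
    (G.deleteEdges {e}).Spans F ↔ G.Spans F := by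
  have hlink {d x y} : (G.deleteEdges {e}).IsLink d x y ↔ G.IsLink d x y ∧ d ≠ e := by simp
  have hdel {u v} (h : (G.deleteEdges {e}).ConnectedIn F u v) : G.ConnectedIn F u v :=
    h.map_id fun d hd u v hl => (hlink.1 hl).1.connectedIn hd
  constructor
  · intro hs d x y hl
    by_cases hd : d = e
    · subst hd
      by_contra hcon
      refine he ⟨x, y, hl, fun h => hcon (h.map_id fun d' hd' u v hl' => ?_)⟩
      exact hdel (hs d' u v (hlink.2 ⟨hl', hd'.2⟩))
    · exact hdel (hs d x y (hlink.2 ⟨hl, hd⟩))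
  · intro hs d x y hl
    exact (hs d x y (hlink.1 hl).1).map_id
      fun d' hd' u v hl' => (hlink.2 ⟨hl', (hF hd').2⟩).connectedIn hd'

theorem isSpanningForest_deleteEdges_iff (he : ¬ G.IsBridge e) {F : Set β}
    (hF : F ⊆ E(G) \ {e}) : (G.deleteEdges {e}).IsSpanningForest F ↔ G.IsSpanningForest F := by
  rw [isSpanningForest_iff, isSpanningForest_iff, spans_deleteEdges_iff he hF]
  have h (d) : (G.deleteEdges {e}).Spans (F \ {d}) ↔ G.Spans (F \ {d}) :=
    spans_deleteEdges_iff he (Set.sdiff_subset.trans hF)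
  simp [h, hF, hF.trans Set.sdiff_subset]

namespace BananaData
variable {H : Graph α β} {x y p q : α} {a c b₀ b₁ b₂ : β}

theorem injective_edgeMap (D : BananaData G H e x y p q a c b₀ b₁ b₂) :
    Function.Injective (edgeMap G e a c b₀ b₁) := by
  have hd (f : β) (hf : f ∉ E(G)) (d : ↥(E(G) \ {e})) : f ≠ d := fun h => hf (h ▸ d.2.1)
  rintro (_ | _ | _ | _ | d) (_ | _ | _ | _ | d') h <;>
    first
    | rfl
    | exact absurd h (hd _ D.ha _)
    | exact absurd h (hd _ D.hc _)
    | exact absurd h (hd _ D.hb₀ _)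
    | exact absurd h (hd _ D.hb₁ _)
    | exact absurd h.symm (hd _ D.ha _)
    | exact absurd h.symm (hd _ D.hc _)
    | exact absurd h.symm (hd _ D.hb₀ _)
    | exact absurd h.symm (hd _ D.hb₁ _)
    | exact absurd h D.hac
    | exact absurd h D.ha₀
    | exact absurd h D.ha₁
    | exact absurd h D.hc₀
    | exact absurd h D.hc₁
    | exact absurd h D.h₀₁
    | exact absurd h.symm D.hac
    | exact absurd h.symm D.ha₀
    | exact absurd h.symm D.ha₁
    | exact absurd h.symm D.hc₀
    | exact absurd h.symm D.hc₁
    | exact absurd h.symm D.h₀₁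
    | exact congrArg (some ∘ some ∘ some ∘ some) (Subtype.ext h)

theorem range_edgeMap (D : BananaData G H e x y p q a c b₀ b₁ b₂) :
    E(H) \ {b₂} = Set.range (edgeMap G e a c b₀ b₁) := by
  ext d
  constructor
  · rintro ⟨hd, hd'⟩
    obtain ⟨u, v, hl⟩ := Graph.exists_isLink_of_mem_edgeSet hd
    obtain ⟨hde, hl⟩ | ⟨rfl, -⟩ | ⟨rfl | rfl | rfl, -⟩ | ⟨rfl, -⟩ := (D.isLink_iff _ _ _).1 hl
    · exact ⟨some (some (some (some ⟨d, hl.edge_mem, hde⟩))), rfl⟩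
    · exact ⟨some (some (some none)), rfl⟩
    · exact ⟨some (some none), rfl⟩
    · exact ⟨some none, rfl⟩
    · exact absurd rfl hd'
    · exact ⟨none, rfl⟩
  · rintro ⟨_ | _ | _ | _ | d, rfl⟩
    · exact ⟨D.link_c.edge_mem, D.hc₂⟩
    · exact ⟨D.link_b₁.edge_mem, D.h₁₂⟩
    · exact ⟨D.link_b₀.edge_mem, D.h₀₂⟩
    · exact ⟨D.link_a.edge_mem, D.ha₂⟩
    · obtain ⟨u, v, hl⟩ := Graph.exists_isLink_of_mem_edgeSet d.2.1
      exact ⟨(D.link_of_ne d.2.2 hl).edge_mem, fun h => D.hb₂ (h ▸ d.2.1)⟩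

end BananaData

variable (K : Type u) [Field K] [Finite E(G)]

variable (G e) in
/-- The class of the locus where the coefficient of the variable of `e` in the Symanzik polynomial
does not vanish. -/
def coefficientClass : GrothendieckRing K :=
  locusClass K (G.forestPolynomial K ((↑) : ↥(E(G) \ {e}) → β) ∅)

theorem grothendieckClass_eq_locusClass :
    G.grothendieckClass K = locusClass K (G.forestPolynomial K ((↑) : E(G) → β) ∅) := by
  have : G.symanzikPolynomial K = G.forestPolynomial K ((↑) : E(G) → β) ∅ := by
    classical
    let : Fintype E(G) := Fintype.ofFinite E(G)
    simp only [forestPolynomial, Set.empty_union, basisPolynomial_eq]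
    unfold symanzikPolynomial
    congr!
  rw [grothendieckClass, hypersurfaceComplement_class, this]
  rfl

theorem grothendieckClass_eq (he : e ∈ E(G)) : G.grothendieckClass K =
    locusClass K (c (G.forestPolynomial K ((↑) : ↥(E(G) \ {e}) → β) ∅) * x +
      c (G.forestPolynomial K ((↑) : ↥(E(G) \ {e}) → β) {e})) := by
  let ι : Option ↥(E(G) \ {e}) → β := fun i => i.elim e (↑)
  have hι : Function.Injective ι := by
    rintro (_ | d) (_ | d') h
    · rfl
    · exact absurd h.symm d'.2.2
    · exact absurd h d.2.2
    · exact congrArg some (Subtype.ext h)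
  obtain ⟨θ, hθ⟩ := exists_algEquiv_forestPolynomial (K := K) (α := α) hι (S := E(G)) (by
    ext d
    simp only [ι, Set.mem_range, Option.exists, Option.elim, Subtype.exists, exists_prop,
      exists_eq_right, Set.mem_sdiff, Set.mem_singleton_iff]
    by_cases hd : d = e
    · simp [hd, he]
    · simp [hd, Ne.symm hd])
  rw [grothendieckClass_eq_locusClass, locusClass_congr (θ.trans (optionEquiv K _)),
    AlgEquiv.trans_apply, hθ, optionEquiv_forestPolynomial]
  simp [ι]

/-- Every spanning forest contains a bridge, so the coefficient is an empty sum and its nonvanishing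
locus is empty. -/
theorem coefficientClass_of_isBridge (he : G.IsBridge e) : G.coefficientClass e K = 0 := by
  have : G.forestPolynomial K ((↑) : ↥(E(G) \ {e}) → β) ∅ = 0 := by
    rw [← basisPolynomial_false]
    unfold forestPolynomial
    congr 1
    ext F
    rw [isSpanningForest_iff]
    have := not_spans_of_isBridge he (F := ∅ ∪ (↑) '' (F : Set ↥(E(G) \ {e}))) <| by
      rintro _ (h | ⟨d, -, rfl⟩)
      exacts [h.elim, d.2]
    simp only [this, false_and, and_false]
  rw [coefficientClass, this, locusClass_zero]

theorem coefficientClass_of_not_isBridge (he : ¬ G.IsBridge e) :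
    G.coefficientClass e K = (G.deleteEdges {e}).grothendieckClass K := by
  obtain ⟨θ, hθ⟩ := exists_algEquiv_forestPolynomial (K := K) (α := α)
    (ι := ((↑) : ↥(E(G) \ {e}) → β)) Subtype.val_injective (S := E(G.deleteEdges {e})) (by
      rw [Subtype.range_coe, Graph.edgeSet_deleteEdges])
  rw [grothendieckClass_eq_locusClass, locusClass_congr θ, hθ, coefficientClass]
  congr 1
  refine forestPolynomial_congr fun F => (isSpanningForest_deleteEdges_iff he ?_).symm
  rintro _ (h | ⟨d, -, rfl⟩)
  exacts [h.elim, d.2]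

namespace BananaData
variable {H : Graph α β} {x y p q : α} {a c b₀ b₁ b₂ : β} [Finite E(H)]

theorem coefficientClass_eq (D : BananaData G H e x y p q a c b₀ b₁ b₂) :
    H.coefficientClass b₂ K = torusClass K * (torusClass K + 1) ^ 2 *
      (G.grothendieckClass K + G.coefficientClass e K) := by
  obtain ⟨θ, hθ⟩ := exists_algEquiv_forestPolynomial (K := K) (α := α) D.injective_edgeMap
    D.range_edgeMap
  rw [coefficientClass, locusClass_congr (θ.trans (edgeEquiv K _)), AlgEquiv.trans_apply, hθ,
    D.edgeEquiv_deletion, locusClass_bananaDeletion, ← grothendieckClass_eq K D.isLink.edge_mem,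
    coefficientClass]

theorem grothendieckClass_eq (D : BananaData G H e x y p q a c b₀ b₁ b₂) :
    H.grothendieckClass K = torusClass K * (torusClass K + 1) ^ 2 *
      ((torusClass K + 1) * G.grothendieckClass K +
        (torusClass K - 1) * G.coefficientClass e K) := by
  obtain ⟨θ, hθ⟩ := exists_algEquiv_forestPolynomial (K := K) (α := α) D.injective_edgeMap
    D.range_edgeMap
  rw [Graph.grothendieckClass_eq K D.link_b₂.edge_mem,
    locusClass_congr (PolyRing.congr (θ.trans (edgeEquiv K _))), map_add, map_mul, congr_c, congr_c,
    congr_x, AlgEquiv.trans_apply, AlgEquiv.trans_apply, hθ, hθ, D.edgeEquiv_deletion,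
    D.edgeEquiv_contraction]
  refine (locusClass_bananaPolynomial _ _).trans ?_
  rw [← Graph.grothendieckClass_eq K D.isLink.edge_mem, coefficientClass]

end BananaData

end
end Graph

/-! ### The generating function and the main theorem. -/

/-- The generating function of a pair of sequences which satisfy a linear recurrence. -/
theorem PowerSeries.mk_eq_of_recurrence {A : Type*} [CommRing A] {f g : ℕ → A} {R T : A}
    (hf : ∀ n, f (n + 1) = R * ((T + 1) * f n + (T - 1) * g n))
    (hg : ∀ n, g (n + 1) = R * (f n + g n)) {r : PowerSeries A} (hr : r = C R * X) :
    mk f = (C (f 0) + C ((T - 1) * g 0 - f 0) * r) *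
      invOfUnit (1 - C (T + 2) * r + 2 * r ^ 2) 1 := by
  have h1 : mk f = C (f 0) + r * (C (T + 1) * mk f + C (T - 1) * mk g) := by
    subst hr
    ext (_ | n)
    · simp
    · rw [mul_comm (C R), mul_assoc]
      rw [map_add, coeff_succ_X_mul, coeff_C_mul, map_add, coeff_C_mul, coeff_C_mul]
      simp [hf]
  have h2 : mk g = C (g 0) + r * (mk f + mk g) := by
    subst hr
    ext (_ | n)
    · simp
    · rw [mul_comm (C R), mul_assoc]
      simp [coeff_succ_X_mul, hg, mul_add]
  -- The denominator is invertible because `r` has no constant term.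
  have h3 : (1 - C (T + 2) * r + 2 * r ^ 2) * invOfUnit (1 - C (T + 2) * r + 2 * r ^ 2) 1 = 1 :=
    mul_invOfUnit _ _ (by simp [hr])
  have h4 : mk f * (1 - C (T + 2) * r + 2 * r ^ 2) = C (f 0) + C ((T - 1) * g 0 - f 0) * r := by
    have e2 : (C (2 : A) : PowerSeries A) = 2 := map_ofNat _ _
    simp only [map_add, map_sub, map_mul, map_one, e2] at h1 h2 ⊢
    -- Cramer's rule: this combination eliminates `mk g`, and the determinant is `(1 - (T + 1)r)(1 -
    -- r) - (T - 1)r² = 1 - (T + 2)r + 2r²`.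
    linear_combination (1 - r) * h1 + (C T - 1) * r * h2
  rw [← h4, mul_assoc, h3, mul_one]

theorem mainTheorem1 {K : Type u} [Field K] {α : Type v} {β : Type u}
    (G : Graph α β) [Finite E(G)] (e : β)
    (Γ : ℕ → Graph α β) [∀ n, Finite E(Γ n)] (ε : ℕ → β)
    (hΓ : G.IsBananaChain e Γ ε)
    (T : GrothendieckRing K) (hT : T = torusClass K)
    (r : PowerSeries (GrothendieckRing K))
    (hr : r = PowerSeries.C (T * (T + 1) ^ 2) * PowerSeries.X) :
    (G.IsBridge e →
      PowerSeries.mk (fun n => (Γ n).grothendieckClass K) =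
        (1 - r) * PowerSeries.invOfUnit (1 - PowerSeries.C (T + 2) * r + 2 * r ^ 2) 1 *
          PowerSeries.C (G.grothendieckClass K)) ∧
    (¬ G.IsBridge e →
      PowerSeries.mk (fun n => (Γ n).grothendieckClass K) =
        (PowerSeries.C (G.grothendieckClass K) +
          PowerSeries.C ((T - 1) * (G.deleteEdges {e}).grothendieckClass K -
            G.grothendieckClass K) * r) *
          PowerSeries.invOfUnit (1 - PowerSeries.C (T + 2) * r + 2 * r ^ 2) 1) := by
  subst hT
  obtain ⟨rfl, rfl, hstep⟩ := hΓ
  have hf (n) : (Γ (n + 1)).grothendieckClass K = torusClass K * (torusClass K + 1) ^ 2 *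
      ((torusClass K + 1) * (Γ n).grothendieckClass K +
        (torusClass K - 1) * (Γ n).coefficientClass (ε n) K) := by
    obtain ⟨x, y, p, q, a, c, b₀, b₁, D⟩ := (hstep n).exists_data
    exact D.grothendieckClass_eq K
  have hg (n) : (Γ (n + 1)).coefficientClass (ε (n + 1)) K =
      torusClass K * (torusClass K + 1) ^ 2 *
        ((Γ n).grothendieckClass K + (Γ n).coefficientClass (ε n) K) := by
    obtain ⟨x, y, p, q, a, c, b₀, b₁, D⟩ := (hstep n).exists_data
    exact D.coefficientClass_eq K
  have h := PowerSeries.mk_eq_of_recurrence (f := fun n => (Γ n).grothendieckClass K)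
    (g := fun n => (Γ n).coefficientClass (ε n) K) hf hg hr
  -- The recurrence is the same in both cases; the bridge condition affects only the initial
  -- coefficient class.
  constructor <;> intro he
  · rw [h, Graph.coefficientClass_of_isBridge K he]
    simp only [mul_zero, zero_sub, map_neg]
    ring
  · rw [h, Graph.coefficientClass_of_not_isBridge K he]
end
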